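/- Let $k$ be an algebraically closed field of characteristic zero and choose $i,\sqrt3\in k$ with $i^2=-1$, $(\sqrt 3)^2=3$. Let $\mathcal X_g$ be a hyperelliptic curve of genus $g\ge 2$ over $k$, i.e. the curve with function field $K=k(x,y)$, $y^2=F(x)$, where $x$ is transcendental over $k$ and $F\in k[X]$ is squarefree of degree $2g+2$ or $2g+1$. Put $\mathrm{Aut}(\mathcal X_g)=\mathrm{Aut}(K/k)$, and let $\overline{\mathrm{Aut}}(\mathcal X_g)=\mathrm{Aut}(K/k)/\mathrm{Gal}(K/k(x))$ be its quotient by the group generated by the hyperelliptic involution. For $\lambda\in k$ let $$G_\lambda(X)=X^{12}-\lambda X^{10}-33X^8+2\lambda X^6-33X^4-\lambda X^2+1 .$$ Suppose that $\overline{\mathrm{Aut}}(\mathcal X_g)\cong A_4$. Then there are an integer $\delta\ge 0$ and pairwise distinct $\lambda_1,\dots,\lambda_\delta\in k$ with $\lambda_j^2\ne-108$ such that, with $G(X)=\prod_{j=1}^{\delta}G_{\lambda_j}(X)$, one of the following holds (exactly one, since the case is determined by $g$ modulo $6$); in each case the equation means that $K=k(X,Y)$ for some $X,Y\in K$, with $X$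 transcendental over $k$, that satisfy it, the right-hand side being a squarefree polynomial of degree $2g+1$ or $2g+2$: 1. $\mathrm{Aut}(\mathcal X_g)\cong\mathbb Z_2\oplus A_4$, $\delta=\frac{g+1}6$, and $\mathcal X_g$ has the equation $Y^2=G(X)$; 2. $\mathrm{Aut}(\mathcal X_g)\cong\mathbb Z_2\oplus A_4$, $\delta=\frac{g-1}6$, and $\mathcal X_g$ has the equation $Y^2=(X^4+2i\sqrt3X^2+1)\,G(X)$; 3. $\mathrm{Aut}(\mathcal X_g)\cong\mathbb Z_2\oplus A_4$, $\delta=\frac{g-3}6\neq0$, and $\mathcal X_g$ has the equation $Y^2=(X^8+14X^4+1)\,G(X)$; 4. $\mathrm{Aut}(\mathcal X_g)\cong SL_2(3)$, $\delta=\frac{g-2}6\neq0$, and $\mathcal X_g$ has the equation $Y^2=X(X^4-1)\,G(X)$; 5. $\mathrm{Aut}(\mathcal X_g)\cong SL_2(3)$, $\delta=\frac{g-4}6$, and $\mathcal X_g$ has the equation $Y^2=X(X^4-1)(X^4+2i\sqrt3X^2+1)\,G(X)$; 6. $\mathrm{Aut}(\mathcal X_g)\cong SL_2(3)$, $\delta=\frac{g-6}6\neq0$,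 and $\mathcal X_g$ has the equation $Y^2=X(X^4-1)(X^8+14X^4+1)\,G(X)$. -/

import Mathlib

open Polynomial

noncomputable section

/-- A hyperelliptic curve of genus `g ≥ 2` over `k` with function field `K`: a presentation
`K = k(x, y)`, `y² = F(x)`, with `x` transcendental over `k` and `F` a squarefree polynomial of
degree `2g + 2`, or `2g + 1` when the point `x = ∞` is a branch point. -/
structure HyperellipticCurve (k K : Type*) [Field k] [Field K] [Algebra k K] (g : ℕ) where
  F : k[X]
  x : K
  y : K
  two_le_genus : 2 ≤ g
  squarefree : Squarefree F
  natDegree_eq : F.natDegree = 2 * g + 1 ∨ F.natDegree = 2 * g + 2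
  transcendental : Transcendental k x
  equation : y ^ 2 = aeval x F
  adjoin_eq_top : IntermediateField.adjoin k {x, y} = ⊤

namespace HyperellipticCurve

section Basic

variable {k K : Type*} [Field k] [Field K] [Algebra k K] {g : ℕ}

/-- The subfield `k(x)` of `K`. -/
def rationalSubfield (C : HyperellipticCurve k K g) : IntermediateField k K :=
  IntermediateField.adjoin k {C.x}

/-- `G₀ = Gal(K / k(x))`, the group generated by the hyperelliptic involution, inside
`G = Aut(K / k)`. -/
def hyperellipticSubgroup (C : HyperellipticCurve k K g) : Subgroup (K ≃ₐ[k] K) :=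
  C.rationalSubfield.fixingSubgroup

lemma aeval_ne_zero (C : HyperellipticCurve k K g) {p : k[X]} (hp : p ≠ 0) :
    aeval C.x p ≠ 0 := fun h => hp ((transcendental_iff.mp C.transcendental) p h)

lemma aeval_mem (C : HyperellipticCurve k K g) (p : k[X]) :
    aeval C.x p ∈ C.rationalSubfield := by
  have h : C.x ∈ C.rationalSubfield := IntermediateField.mem_adjoin_simple_self k C.x
  have h2 := Polynomial.aeval_algHom_apply C.rationalSubfield.val ⟨C.x, h⟩ p
  simp only [IntermediateField.coe_val] at h2
  rw [h2]
  exact Subtype.property _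

/-- Every element of `K` is `(p(x) + q(x) y) / d(x)`. -/
lemma exists_repr [CharZero k] (C : HyperellipticCurve k K g) (z : K) :
    ∃ d p q : k[X], d ≠ 0 ∧ aeval C.x d * z = aeval C.x p + aeval C.x q * C.y := by
  have : CharZero K := charZero_of_injective_algebraMap (algebraMap k K).injective
  have hz : z ∈ IntermediateField.adjoin k {C.x, C.y} := by
    rw [C.adjoin_eq_top]; trivial
  induction hz using IntermediateField.adjoin_induction with
  | mem z hz =>
    rcases hz with rfl | rfl
    · exact ⟨1, X, 0, one_ne_zero, by simp⟩
    · exact ⟨1, 0, 1, one_ne_zero, by simp⟩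
  | algebraMap a => exact ⟨1, Polynomial.C a, 0, one_ne_zero, by simp⟩
  | add a b _ _ ha hb =>
    obtain ⟨d, p, q, hd, h⟩ := ha
    obtain ⟨d', p', q', hd', h'⟩ := hb
    refine ⟨d * d', d' * p + d * p', d' * q + d * q', mul_ne_zero hd hd', ?_⟩
    simp only [map_add, map_mul]
    linear_combination (aeval C.x d') * h + (aeval C.x d) * h'
  | mul a b _ _ ha hb =>
    obtain ⟨d, p, q, hd, h⟩ := ha
    obtain ⟨d', p', q', hd', h'⟩ := hb
    refine ⟨d * d', p * p' + q * q' * C.F, p * q' + q * p', mul_ne_zero hd hd', ?_⟩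
    simp only [map_add, map_mul, ← C.equation]
    linear_combination (aeval C.x d' * b) * h + (aeval C.x p + aeval C.x q * C.y) * h'
  | inv a _ ha =>
    obtain ⟨d, p, q, hd, h⟩ := ha
    by_cases ha0 : a = 0
    · exact ⟨1, 0, 0, one_ne_zero, by simp [ha0]⟩
    have hN : (aeval C.x p + aeval C.x q * C.y) * (aeval C.x p - aeval C.x q * C.y)
        = aeval C.x (p ^ 2 - q ^ 2 * C.F) := by
      simp only [map_sub, map_mul, map_pow, ← C.equation]; ring
    by_cases hn : p ^ 2 - q ^ 2 * C.F = 0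
    · rw [hn, map_zero, ← h] at hN
      have h0 : aeval C.x p - aeval C.x q * C.y = 0 :=
        (mul_eq_zero.mp hN).resolve_left (mul_ne_zero (C.aeval_ne_zero hd) ha0)
      have h2 : aeval C.x d * a = 2 * aeval C.x p := by linear_combination h - h0
      refine ⟨2 * p, d, 0, ?_, ?_⟩
      · intro hp
        have : aeval C.x (2 * p) = 0 := by rw [hp, map_zero]
        rw [map_mul, map_ofNat, ← h2] at this
        exact mul_ne_zero (C.aeval_ne_zero hd) ha0 this
      · simp only [map_mul, map_ofNat, ← h2, map_zero]
        field_simp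
        simp
    · refine ⟨p ^ 2 - q ^ 2 * C.F, d * p, - (d * q), hn, ?_⟩
      rw [← hN, ← h]
      simp only [map_mul, map_neg]
      field_simp
      ring

/-- Transport along an automorphism of the function field. -/
def map (C : HyperellipticCurve k K g) (σ : K ≃ₐ[k] K) : HyperellipticCurve k K g where
  F := C.F
  x := σ C.x
  y := σ C.y
  two_le_genus := C.two_le_genus
  squarefree := C.squarefree
  natDegree_eq := C.natDegree_eq
  transcendental := by
    rw [transcendental_iff]
    intro p hp
    have : σ (aeval C.x p) = 0 := by
      rw [← hp]; exact (Polynomial.aeval_algHom_apply σ C.x p).symm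
    exact transcendental_iff.mp C.transcendental p ((map_eq_zero σ).mp this)
  equation := by
    rw [← map_pow, C.equation]; exact (Polynomial.aeval_algHom_apply σ C.x C.F).symm
  adjoin_eq_top := by
    have h := IntermediateField.adjoin_map k {C.x, C.y} (σ : K →ₐ[k] K)
    rw [C.adjoin_eq_top, Set.image_pair] at h
    rw [eq_top_iff]
    intro z _
    have hz : z ∈ (⊤ : IntermediateField k K).map (σ : K →ₐ[k] K) :=
      ⟨σ.symm z, trivial, by simp⟩
    rw [h] at hz
    exact hz

/-- Every element of `K` is a root of a nonzero polynomial of degree at most two over `k[x]`. -/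
lemma exists_quadratic [CharZero k] (C : HyperellipticCurve k K g) (z : K) :
    ∃ Q : k[X][X], Q ≠ 0 ∧ Q.natDegree ≤ 2 ∧ aevalAeval C.x z Q = 0 := by
  obtain ⟨d, p, q, hd, h⟩ := C.exists_repr z
  refine ⟨Polynomial.C (d ^ 2) * X ^ 2 + Polynomial.C (- (2 * d * p)) * X +
    Polynomial.C (p ^ 2 - q ^ 2 * C.F), ?_, natDegree_quadratic_le, ?_⟩
  · intro h0
    have := congrArg (fun r => coeff r 2) h0
    simp only [coeff_add, coeff_C_mul, coeff_X_pow, coeff_X, coeff_C, coeff_zero] at this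
    simp [hd] at this
  · simp only [map_add, map_mul, map_pow, aevalAeval_C, aevalAeval_Y, map_neg, map_sub,
      map_ofNat, ← C.equation]
    linear_combination (aeval C.x d * z - aeval C.x p + aeval C.x q * C.y) * h

/-- If an irreducible bivariate polynomial of positive degree vanishes at `(x, u)`, it divides
every bivariate polynomial which vanishes there. -/
lemma dvd_of_aevalAeval_eq_zero {x u : K} (hx : Transcendental k x) {P Q : k[X][X]}
    (hP : Irreducible P) (hdeg : P.natDegree ≠ 0) (hP0 : aevalAeval x u P = 0)
    (hQ0 : aevalAeval x u Q = 0) : P ∣ Q := by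
  let : Algebra k[X] K := (aeval x).toAlgebra
  have hinj : Function.Injective (algebraMap k[X] K) := transcendental_iff_injective.mp hx
  have : FaithfulSMul k[X] K := (faithfulSMul_iff_algebraMap_injective k[X] K).mpr hinj
  let : Algebra (FractionRing k[X]) K := FractionRing.liftAlgebra k[X] K
  have : IsScalarTower k[X] (FractionRing k[X]) K := FractionRing.isScalarTower_liftAlgebra k[X] K
  have key : ∀ R : k[X][X], aevalAeval x u R = 0 →
      aeval u (R.map (algebraMap k[X] (FractionRing k[X]))) = 0 := by
    intro R hR
    have h : ∀ S : k[X][X], aeval u S = aevalAeval x u S := by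
      intro S
      induction S using Polynomial.induction_on' with
      | add p q hp hq => rw [map_add, map_add, hp, hq]
      | monomial n a =>
        rw [aeval_monomial, ← C_mul_X_pow_eq_monomial, map_mul, map_pow, aevalAeval_C, aevalAeval_Y]
        rfl
    rw [aeval_map_algebraMap, h, hR]
  have hprim := hP.isPrimitive hdeg
  let : NormalizedGCDMonoid k[X] := Classical.choice inferInstance
  have hirr : Irreducible (P.map (algebraMap k[X] (FractionRing k[X]))) :=
    (hprim.irreducible_iff_irreducible_map_fraction_map).mp hP
  apply hprim.dvd_of_fraction_map_dvd_fraction_map (K := FractionRing k[X])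
  have h1 := minpoly.dvd _ _ (key P hP0)
  have h2 := minpoly.dvd _ _ (key Q hQ0)
  have hint : IsIntegral (FractionRing k[X]) u :=
    (isAlgebraic_iff_isIntegral).mp ⟨_, hirr.ne_zero, key P hP0⟩
  exact ((minpoly.irreducible hint).dvd_symm hirr h1).trans h2

lemma natDegree_coeff_le_natDegree_swap (P : k[X][X]) (j : ℕ) :
    (P.coeff j).natDegree ≤ (Bivariate.swap P).natDegree := by
  have key : ∀ (P : k[X][X]) (i j : ℕ),
      ((Bivariate.swap P).coeff i).coeff j = (P.coeff j).coeff i := by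
    intro P i j
    induction P using Polynomial.induction_on' with
    | add p q hp hq => simp only [map_add, coeff_add, hp, hq]
    | monomial n a =>
      induction a using Polynomial.induction_on' with
      | add p q hp hq => simp only [map_add, coeff_add, hp, hq]
      | monomial m r =>
        rw [Bivariate.swap_monomial_monomial]
        simp only [coeff_monomial]
        split_ifs <;> simp_all [coeff_monomial]
  rw [natDegree_le_iff_coeff_eq_zero]
  intro i hi
  rw [← key, coeff_eq_zero_of_natDegree_lt hi, coeff_zero]

lemma mem_rationalSubfield_of_mul (C : HyperellipticCurve k K g) {a b : k[X]} {z : K}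
    (ha : a ≠ 0) (h : aeval C.x a * z = aeval C.x b) : z ∈ C.rationalSubfield := by
  have : z = aeval C.x b / aeval C.x a := by
    rw [eq_div_iff (C.aeval_ne_zero ha), mul_comm, h]
  rw [this]
  exact div_mem (C.aeval_mem b) (C.aeval_mem a)

lemma natDegree_le_of_sq_mul_eq {e d F D : k[X]} (he : e ≠ 0) (hd : d ≠ 0) (hF : Squarefree F)
    (h : e ^ 2 * F = d ^ 2 * D) : F.natDegree ≤ D.natDegree := by
  have hD : D ≠ 0 := by
    rintro rfl
    have := hF.ne_zero
    simp_all
  classical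
  have hg : EuclideanDomain.gcd e d ≠ 0 := fun h0 => hd (EuclideanDomain.gcd_eq_zero_iff.mp h0).2
  obtain ⟨e', h1⟩ := EuclideanDomain.gcd_dvd_left e d
  obtain ⟨d', h2⟩ := EuclideanDomain.gcd_dvd_right e d
  have hco : IsCoprime e' d' := by
    refine ⟨EuclideanDomain.gcdA e d, EuclideanDomain.gcdB e d, mul_left_cancel₀ hg ?_⟩
    have := EuclideanDomain.gcd_eq_gcd_ab e d
    linear_combination (-1 : k[X]) * this - EuclideanDomain.gcdA e d * h1
      - EuclideanDomain.gcdB e d * h2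
  have h' : e' ^ 2 * F = d' ^ 2 * D := by
    refine mul_left_cancel₀ (pow_ne_zero 2 hg) ?_
    rw [← mul_assoc, ← mul_assoc, ← mul_pow, ← mul_pow, ← h1, ← h2, h]
  have hdvd : d' * d' ∣ F := by
    rw [← pow_two]
    exact hco.symm.pow.dvd_of_dvd_mul_left (Dvd.intro _ h'.symm)
  have hu : IsUnit (d' ^ 2) := (hF d' hdvd).pow 2
  have hFD : F ∣ D := (hu.dvd_mul_left).mp (Dvd.intro_left _ h')
  exact natDegree_le_of_dvd hFD hD

/-- The automorphisms of `K` preserve `k(x)`. -/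
lemma apply_x_mem [CharZero k] (C : HyperellipticCurve k K g) (σ : K ≃ₐ[k] K) :
    σ C.x ∈ C.rationalSubfield := by
  by_contra hu
  set u : K := σ C.x with hudef
  obtain ⟨Q₁, hQ₁, hQ₁deg, hQ₁0⟩ := C.exists_quadratic u
  obtain ⟨Q₂, hQ₂, hQ₂deg, hQ₂0⟩ := (C.map σ).exists_quadratic C.x
  obtain ⟨P, hP, hPQ₁, hP0⟩ : ∃ P : k[X][X], Irreducible P ∧ P ∣ Q₁ ∧ aevalAeval C.x u P = 0 := by
    obtain ⟨v, hv⟩ := UniqueFactorizationMonoid.factors_prod hQ₁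
    rw [← hv, map_mul, mul_eq_zero] at hQ₁0
    have hv0 : aevalAeval C.x u (v : k[X][X]) ≠ 0 := (v.isUnit.map (aevalAeval C.x u)).ne_zero
    have h0 := hQ₁0.resolve_right hv0
    rw [map_multiset_prod, Multiset.prod_eq_zero_iff, Multiset.mem_map] at h0
    obtain ⟨P, hPm, hP0⟩ := h0
    exact ⟨P, UniqueFactorizationMonoid.irreducible_of_factor P hPm,
      UniqueFactorizationMonoid.dvd_of_mem_factors hPm, hP0⟩
  have hPdeg : P.natDegree ≤ 2 := (natDegree_le_of_dvd hPQ₁ hQ₁).trans hQ₁deg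
  have hPdeg0 : P.natDegree ≠ 0 := by
    intro h0
    rw [eq_C_of_natDegree_eq_zero h0, aevalAeval_C] at hP0
    have h1 : P.coeff 0 = 0 := by
      by_contra h1; exact C.aeval_ne_zero h1 hP0
    rw [eq_C_of_natDegree_eq_zero h0, h1, map_zero] at hP
    exact hP.ne_zero rfl
  have hdvd : P ∣ Bivariate.swap Q₂ := by
    refine dvd_of_aevalAeval_eq_zero C.transcendental hP hPdeg0 hP0 ?_
    rw [Bivariate.aevalAeval_swap]; exact hQ₂0
  have hswap : (Bivariate.swap P).natDegree ≤ 2 := by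
    have h1 : Bivariate.swap P ∣ Q₂ := by
      have := map_dvd (Bivariate.swap (R := k)) hdvd
      rwa [Bivariate.swap_swap_apply] at this
    exact (natDegree_le_of_dvd h1 hQ₂).trans hQ₂deg
  have hc : ∀ j, (P.coeff j).natDegree ≤ 2 := fun j =>
    (natDegree_coeff_le_natDegree_swap P j).trans hswap
  obtain ⟨α, β, γ, hα, hβ, hγ, hPe⟩ : ∃ α β γ : k[X], α.natDegree ≤ 2 ∧ β.natDegree ≤ 2 ∧
      γ.natDegree ≤ 2 ∧ P = Polynomial.C α * X ^ 2 + Polynomial.C β * X + Polynomial.C γ := by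
    refine ⟨P.coeff 2, P.coeff 1, P.coeff 0, hc 2, hc 1, hc 0, ?_⟩
    conv_lhs => rw [P.as_sum_range' 3 (by omega)]
    simp [Finset.sum_range_succ, ← C_mul_X_pow_eq_monomial]
    ring
  have hrel : aeval C.x α * u ^ 2 + aeval C.x β * u + aeval C.x γ = 0 := by
    rw [hPe] at hP0
    simpa only [map_add, map_mul, map_pow, aevalAeval_C, aevalAeval_Y] using hP0
  have hα0 : α ≠ 0 := by
    rintro rfl
    rcases eq_or_ne β 0 with rfl | hβ0
    · rw [hPe] at hPdeg0; simp at hPdeg0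
    · refine hu (C.mem_rationalSubfield_of_mul (a := β) (b := - γ) hβ0 ?_)
      rw [map_neg]; rw [map_zero] at hrel; linear_combination hrel
  obtain ⟨d, p, q, hd, hdu⟩ := C.exists_repr u
  have hq0 : q ≠ 0 := by
    rintro rfl
    exact hu (C.mem_rationalSubfield_of_mul hd (by simpa using hdu))
  have hy : C.y ∉ C.rationalSubfield := by
    intro hy
    apply hu
    have : u = (aeval C.x p + aeval C.x q * C.y) / aeval C.x d := by
      rw [eq_div_iff (C.aeval_ne_zero hd), mul_comm, hdu]
    rw [this]
    exact div_mem (add_mem (C.aeval_mem p) (mul_mem (C.aeval_mem q) hy)) (C.aeval_mem d)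
  have hexp : aeval C.x ((2 * α * p + d * β) ^ 2 + (2 * α * q) ^ 2 * C.F
        + 2 * (2 * α * p + d * β) * (2 * α * q) * 0 - d ^ 2 * (β ^ 2 - 4 * α * γ))
      + aeval C.x (2 * (2 * α * p + d * β) * (2 * α * q)) * C.y = 0 := by
    simp only [map_add, map_mul, map_pow, map_sub, map_ofNat, map_zero, ← C.equation]
    generalize aeval C.x α = α at *
    generalize aeval C.x β = β at *
    generalize aeval C.x γ = γ at *
    generalize aeval C.x d = d at *
    generalize aeval C.x p = p at *
    generalize aeval C.x q = q at *
    have h1 : 2 * α * p + d * β + 2 * α * q * C.y = d * (2 * α * u + β) := by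
      linear_combination (- 2 * α) * hdu
    have h2 : (2 * α * u + β) ^ 2 = β ^ 2 - 4 * α * γ := by linear_combination 4 * α * hrel
    have h3 : (2 * α * p + d * β + 2 * α * q * C.y) ^ 2 = d ^ 2 * (β ^ 2 - 4 * α * γ) := by
      rw [h1, mul_pow, h2]
    linear_combination h3
  have h2 : (2 : k[X]) ≠ 0 := two_ne_zero
  have hc0 : 2 * α * p + d * β = 0 := by
    by_contra hc0
    refine hy (C.mem_rationalSubfield_of_mul (a := 2 * (2 * α * p + d * β) * (2 * α * q))
      (b := - ((2 * α * p + d * β) ^ 2 + (2 * α * q) ^ 2 * C.F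
        + 2 * (2 * α * p + d * β) * (2 * α * q) * 0 - d ^ 2 * (β ^ 2 - 4 * α * γ))) ?_ ?_)
    · exact mul_ne_zero (mul_ne_zero h2 hc0) (mul_ne_zero (mul_ne_zero h2 hα0) hq0)
    · rw [map_neg]; linear_combination hexp
  rw [hc0] at hexp
  have hpoly : (2 * α * q) ^ 2 * C.F = d ^ 2 * (β ^ 2 - 4 * α * γ) := by
    have h0 : aeval C.x ((2 * α * q) ^ 2 * C.F - d ^ 2 * (β ^ 2 - 4 * α * γ)) = 0 := by
      simpa using hexp
    by_contra hne
    exact C.aeval_ne_zero (sub_ne_zero.mpr hne) h0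
  have hdeg := natDegree_le_of_sq_mul_eq (mul_ne_zero (mul_ne_zero h2 hα0) hq0) hd C.squarefree hpoly
  have hD : (β ^ 2 - 4 * α * γ).natDegree ≤ 4 := by
    compute_degree
    all_goals omega
  have := C.two_le_genus
  rcases C.natDegree_eq with h | h <;> omega

/-- `G₀` is normal in `G`. -/
instance hyperellipticSubgroup_normal [CharZero k] (C : HyperellipticCurve k K g) :
    C.hyperellipticSubgroup.Normal := by
  refine ⟨fun n hn σ => ?_⟩
  rw [hyperellipticSubgroup, IntermediateField.mem_fixingSubgroup_iff] at hn ⊢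
  have hle : C.rationalSubfield ≤ C.rationalSubfield.comap ((σ⁻¹ : K ≃ₐ[k] K) : K →ₐ[k] K) := by
    conv_lhs => rw [rationalSubfield]
    rw [IntermediateField.adjoin_simple_le_iff]
    exact C.apply_x_mem σ⁻¹
  intro z hz
  have h := hn _ (hle hz)
  have h' : σ (n (σ⁻¹ z)) = σ (σ⁻¹ z) := congrArg σ h
  rw [AlgEquiv.mul_apply, AlgEquiv.mul_apply, h']
  exact σ.apply_symm_apply z

/-- The reduced automorphism group `G / G₀`, where `G = Aut(K / k)`. -/
abbrev ReducedAut (C : HyperellipticCurve k K g) : Type _ :=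
  (K ≃ₐ[k] K) ⧸ C.hyperellipticSubgroup

end Basic

end HyperellipticCurve

/-- The function field `K` is that of a genus `g` hyperelliptic curve with equation
`Y² = P(X)`: there are generators `X, Y` of `K` over `k` satisfying this equation. -/
def HasHyperellipticEquation (k K : Type*) [Field k] [Field K] [Algebra k K] (g : ℕ)
    (P : k[X]) : Prop :=
  ∃ C : HyperellipticCurve k K g, C.F = P

/-- `G_λ(X) = X¹² - λX¹⁰ - 33X⁸ + 2λX⁶ - 33X⁴ - λX² + 1`. -/
def orbitPoly {k : Type*} [Field k] (a : k) : k[X] :=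
  X ^ 12 - C a * X ^ 10 - 33 * X ^ 8 + C (2 * a) * X ^ 6 - 33 * X ^ 4 - C a * X ^ 2 + 1

/-- `G(X) = ∏ G_{λ_j}(X)`. -/
def orbitProd {k : Type*} [Field k] {δ : ℕ} (lam : Fin δ → k) : k[X] :=
  ∏ j, orbitPoly (lam j)

/-- `T(X) = X⁴ + 2i√3 X² + 1`, where `r` stands for `√3`. -/
def polyT {k : Type*} [Field k] (i r : k) : k[X] :=
  X ^ 4 + C (2 * i * r) * X ^ 2 + 1

/-- `R(X) = X(X⁴ - 1)`. -/
def polyR (k : Type*) [Field k] : k[X] := X * (X ^ 4 - 1)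

/-- `S(X)T(X) = X⁸ + 14X⁴ + 1`. -/
def polyST (k : Type*) [Field k] : k[X] := X ^ 8 + 14 * X ^ 4 + 1

end

/-! Every automorphism of `K` preserves `k(x)`, so it acts on `x` by a Möbius transformation
(`exists_moebius`). The reduced group is thus a copy of A₄ in PGL₂(k) that permutes the branch
points, namely the roots of `F`, together with ∞ when the degree is odd. Over an algebraically
closed field the coordinate can be chosen so that the Klein four-group acts by X ↦ -X and X ↦ 1/X
and an element of order three by X ↦ ±i(X + 1)/(X - 1), up to X ↦ -X
(`exists_tetrahedral_coordinate`).

The branch points are a union of A₄-orbits on the projective line. One orbit has six points, the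
roots of R = X(X⁴ - 1) and ∞. Two have four points, the roots of T and of S = `polyT (-i) r`. All
others have twelve. The quotient map by A₄ is N/R² with N = X¹² - 33X⁸ - 33X⁴ + 1, so an orbit of
twelve is the zero set of some G_λ = N - λR². The fibres over λ² = -108 are the cubes T³ and S³,
which is why these values are excluded. Hence F is a constant times a product of distinct factors
among R, T, S and the G_λ (`exists_factorization`). The substitution X ↦ iX normalises A₄, exchanges
T and S, fixes R up to a constant and sends G_λ to G_{-λ}. It therefore reduces the choices for the
T, S part to 1, T and ST (`exists_standard_form`). Comparing degrees gives g.

The full group is a central extension of A₄ by the hyperelliptic involution z. Lifts I, J, T of the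
generators can be normalised so that the only freedom left is whether I² is 1 or z, and the two
possibilities are Z₂ × A₄ and SL₂(3) (`exists_tetrahedralRelations`, `nonempty_mulEquiv`). Since I
sends X to -X, I² is read off from the parity of F: F is even without the factor R and odd with it
(`involution_lift_sq_apply`).

If δ = 0 and F is ST, R or R·ST, then X ↦ iX lifts to a further automorphism, of order four in the
reduced group. A₄ has no element of order four, so δ ≠ 0 in those cases (`exists_pow_six_notMem`).
-/

namespace HyperellipticCurve

/-! ### Automorphisms act on `x` by Möbius transformations, and on the branch form up to squares. -/

section Moebius

variable {k K : Type*} [Field k] [Field K] [Algebra k K] {g : ℕ}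

/-- The homogenization of `F` in degree `N`, evaluated at a pair of polynomials. -/
noncomputable def homSubst (N : ℕ) (F P Q : k[X]) : k[X] :=
  ∑ j ∈ Finset.range (N + 1), Polynomial.C (F.coeff j) * P ^ j * Q ^ (N - j)

lemma aeval_homSubst {A : Type*} [CommRing A] [Algebra k A] {x u : A} {N : ℕ} {F P Q : k[X]}
    (hN : F.natDegree ≤ N) (h : u * aeval x Q = aeval x P) :
    aeval x (homSubst N F P Q) = aeval u F * aeval x Q ^ N := by
  rw [homSubst, aeval_eq_sum_range' (Nat.lt_succ_of_le hN) u, Finset.sum_mul, map_sum]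
  refine Finset.sum_congr rfl fun j hj => ?_
  have hj' : j ≤ N := Nat.lt_succ_iff.mp (Finset.mem_range.mp hj)
  simp only [map_mul, map_pow, aeval_C, ← h, Algebra.smul_def]
  obtain ⟨m, rfl⟩ := Nat.exists_eq_add_of_le hj'
  rw [Nat.add_sub_cancel_left]
  ring

lemma eval_homSubst {p u : k} {N : ℕ} {F P Q : k[X]}
    (hN : F.natDegree ≤ N) (h : u * eval p Q = eval p P) :
    eval p (homSubst N F P Q) = eval u F * eval p Q ^ N := by
  simpa using aeval_homSubst (A := k) (x := p) (u := u) hN (by simpa using h)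

/-- Modulo Q only the term without a factor Q survives. This and its mirror image modulo P bound the
degrees in `exists_moebius`. -/
lemma dvd_homSubst_sub_left (N : ℕ) (F P Q : k[X]) :
    Q ∣ homSubst N F P Q - Polynomial.C (F.coeff N) * P ^ N := by
  rw [homSubst, Finset.sum_range_succ, Nat.sub_self, pow_zero, mul_one, add_sub_cancel_right]
  refine Finset.dvd_sum fun j hj => Dvd.dvd.mul_left (dvd_pow_self _ ?_) _
  have := Finset.mem_range.mp hj
  omega

lemma dvd_homSubst_sub_right (N : ℕ) (F P Q : k[X]) :
    P ∣ homSubst N F P Q - Polynomial.C (F.coeff 0) * Q ^ N := by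
  rw [homSubst, Finset.sum_range_succ', Nat.sub_zero, pow_zero, mul_one, add_sub_cancel_right]
  exact Finset.dvd_sum fun j hj => ((dvd_pow_self _ (Nat.succ_ne_zero j)).mul_left _).mul_right _

/-- Otherwise F would be a square in k(x), which a squarefree polynomial of positive degree is not.
-/
lemma y_notMem (C : HyperellipticCurve k K g) : C.y ∉ C.rationalSubfield := by
  intro hy
  obtain ⟨p, q, h⟩ := (IntermediateField.mem_adjoin_simple_iff k C.y).mp hy
  have hF : C.F ≠ 0 := C.squarefree.ne_zero
  have hy0 : C.y ≠ 0 := by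
    intro h0
    have := C.equation
    rw [h0, zero_pow two_ne_zero] at this
    exact C.aeval_ne_zero hF this.symm
  have hq : q ≠ 0 := by rintro rfl; simp [hy0] at h
  have hp : p ≠ 0 := by rintro rfl; simp [hy0] at h
  rw [eq_div_iff (C.aeval_ne_zero hq)] at h
  have h1 : q ^ 2 * C.F = p ^ 2 * 1 := by
    have h0 : aeval C.x (q ^ 2 * C.F - p ^ 2 * 1) = 0 := by
      simp only [map_sub, map_mul, map_pow, ← C.equation, ← h, map_one]; ring
    by_contra hne
    exact C.aeval_ne_zero (sub_ne_zero.mpr hne) h0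
  have h2 := natDegree_le_of_sq_mul_eq hq hp C.squarefree h1
  have := C.two_le_genus
  rw [natDegree_one] at h2
  rcases C.natDegree_eq with h | h <;> omega

lemma add_mul_y_eq_zero (C : HyperellipticCurve k K g) {p q : k[X]}
    (h : aeval C.x p + aeval C.x q * C.y = 0) : p = 0 ∧ q = 0 := by
  have hq : q = 0 := by
    by_contra hq
    refine C.y_notMem (C.mem_rationalSubfield_of_mul (a := q) (b := -p) hq ?_)
    rw [map_neg]; linear_combination h
  subst hq
  refine ⟨?_, rfl⟩
  by_contra hp
  exact C.aeval_ne_zero hp (by simpa using h)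

lemma exists_coprime_of_mem (C : HyperellipticCurve k K g) {z : K}
    (hz : z ∈ C.rationalSubfield) :
    ∃ p q : k[X], IsCoprime p q ∧ q ≠ 0 ∧ z * aeval C.x q = aeval C.x p := by
  obtain ⟨p, q, h⟩ := (IntermediateField.mem_adjoin_simple_iff k z).mp hz
  by_cases hq : q = 0
  · exact ⟨0, 1, isCoprime_one_right, one_ne_zero, by simp [h, hq]⟩
  rw [eq_div_iff (C.aeval_ne_zero hq)] at h
  classical
  have hg : EuclideanDomain.gcd p q ≠ 0 := fun h0 => hq (EuclideanDomain.gcd_eq_zero_iff.mp h0).2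
  obtain ⟨p', h1⟩ := EuclideanDomain.gcd_dvd_left p q
  obtain ⟨q', h2⟩ := EuclideanDomain.gcd_dvd_right p q
  refine ⟨p', q', ⟨EuclideanDomain.gcdA p q, EuclideanDomain.gcdB p q, mul_left_cancel₀ hg ?_⟩,
    ?_, mul_left_cancel₀ (C.aeval_ne_zero hg) ?_⟩
  · have := EuclideanDomain.gcd_eq_gcd_ab p q
    linear_combination (-1 : k[X]) * this - EuclideanDomain.gcdA p q * h1
      - EuclideanDomain.gcdB p q * h2
  · rintro rfl; rw [mul_zero] at h2; exact hq h2
  · rw [← map_mul, ← h1, ← h]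
    conv_rhs => rw [h2]
    rw [map_mul]; ring

lemma apply_mem [CharZero k] (C : HyperellipticCurve k K g) (σ : K ≃ₐ[k] K) {z : K}
    (hz : z ∈ C.rationalSubfield) : σ z ∈ C.rationalSubfield := by
  obtain ⟨p, q, h⟩ := (IntermediateField.mem_adjoin_simple_iff k z).mp hz
  have hle : ∀ p : k[X], σ (aeval C.x p) ∈ C.rationalSubfield := by
    intro p
    have : C.rationalSubfield ≤ C.rationalSubfield.comap (σ : K →ₐ[k] K) := by
      conv_lhs => rw [rationalSubfield]
      rw [IntermediateField.adjoin_simple_le_iff]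
      exact C.apply_x_mem σ
    exact this (C.aeval_mem p)
  rw [h, map_div₀]
  exact div_mem (hle p) (hle q)

lemma aeval_injective (C : HyperellipticCurve k K g) {p q : k[X]}
    (h : aeval C.x p = aeval C.x q) : p = q := by
  by_contra hne
  exact C.aeval_ne_zero (sub_ne_zero.mpr hne) (by rw [map_sub, h, sub_self])

lemma natDegree_le_one_of_dvd {s r : k} {P : k[X]} (hsr : s ≠ 0 ∨ r ≠ 0)
    (h : P ∣ Polynomial.C s * X - Polynomial.C r) : P.natDegree ≤ 1 := by
  have hne : Polynomial.C s * X - Polynomial.C r ≠ 0 := by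
    intro h0
    have h1 := congrArg (fun f => coeff f 1) h0
    have h2 := congrArg (fun f => coeff f 0) h0
    simp [coeff_C] at h1 h2
    rcases hsr with h | h <;> contradiction
  refine (natDegree_le_of_dvd h hne).trans ?_
  compute_degree

/-- The automorphisms of `K` act on `x` by Möbius transformations. -/
lemma exists_moebius [CharZero k] (C : HyperellipticCurve k K g) (σ : K ≃ₐ[k] K) :
    ∃ a b c d : k, a * d - b * c ≠ 0 ∧
      σ C.x * aeval C.x (Polynomial.C c * X + Polynomial.C d)
        = aeval C.x (Polynomial.C a * X + Polynomial.C b) := by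
  obtain ⟨p, q, hpq, hq, hu⟩ := C.exists_coprime_of_mem (C.apply_x_mem σ)
  obtain ⟨r, s, hrs, hs, hv⟩ := C.exists_coprime_of_mem (C.apply_x_mem σ.symm)
  set u := σ C.x with hudef
  have hσ : ∀ f : k[X], σ (aeval C.x f) = aeval u f := fun f =>
    (Polynomial.aeval_algHom_apply σ C.x f).symm
  have hv' : C.x * aeval u s = aeval u r := by
    have := congrArg σ hv
    rwa [map_mul, AlgEquiv.apply_symm_apply, hσ, hσ] at this
  set n := max r.natDegree s.natDegree with hn
  have hS := aeval_homSubst (N := n) (le_max_right r.natDegree s.natDegree) hu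
  have hR := aeval_homSubst (N := n) (le_max_left r.natDegree s.natDegree) hu
  -- With u = p(x)/q(x) and x = r(u)/s(u), clearing denominators gives this identity in k[X].
  -- Reduced modulo q, it gives q ∣ s_n X - r_n because p and q are coprime; reduced modulo p, it
  -- gives p ∣ s₀ X - r₀. So both degrees are at most one.
  have key : X * homSubst n s p q = homSubst n r p q := by
    apply C.aeval_injective
    rw [map_mul, aeval_X, hS, hR, ← hv']; ring
  have hlead : s.coeff n ≠ 0 ∨ r.coeff n ≠ 0 := by
    rcases max_choice r.natDegree s.natDegree with h | h
    · by_cases hr : r = 0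
      · subst hr
        rw [isCoprime_zero_left] at hrs
        left
        rw [natDegree_zero, natDegree_eq_zero_of_isUnit hrs] at hn
        rw [eq_C_of_natDegree_eq_zero (natDegree_eq_zero_of_isUnit hrs)] at hs
        rw [hn]; simpa using hs
      · right; rw [hn, h]; exact leadingCoeff_ne_zero.mpr hr
    · left; rw [hn, h]; exact leadingCoeff_ne_zero.mpr hs
  have htrail : s.coeff 0 ≠ 0 ∨ r.coeff 0 ≠ 0 := by
    by_contra! h
    have := hrs.isUnit_of_dvd' (X_dvd_iff.mpr h.2) (X_dvd_iff.mpr h.1)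
    exact not_isUnit_X this
  have hq1 : q.natDegree ≤ 1 := by
    refine natDegree_le_one_of_dvd hlead
      ((hpq.symm.pow_right (n := n)).dvd_of_dvd_mul_right ?_)
    have h1 := (dvd_homSubst_sub_left n s p q).mul_left X
    have h2 := dvd_homSubst_sub_left n r p q
    have := dvd_sub h2 h1
    rw [← key] at this
    convert this using 1
    ring
  have hp1 : p.natDegree ≤ 1 := by
    refine natDegree_le_one_of_dvd htrail
      ((hpq.pow_right (n := n)).dvd_of_dvd_mul_right ?_)
    have h1 := (dvd_homSubst_sub_right n s p q).mul_left X
    have h2 := dvd_homSubst_sub_right n r p q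
    have := dvd_sub h2 h1
    rw [← key] at this
    convert this using 1
    ring
  refine ⟨p.coeff 1, p.coeff 0, q.coeff 1, q.coeff 0, ?_, ?_⟩
  -- A vanishing determinant makes p a constant multiple of q. Then σ x is constant, and so is x.
  · intro hdet
    obtain ⟨e, he⟩ : ∃ e : k, p = Polynomial.C e * q := by
      by_cases hc : q.coeff 1 = 0
      · have hd : q.coeff 0 ≠ 0 := by
          intro hd
          apply hq
          rw [eq_X_add_C_of_natDegree_le_one hq1, hc, hd]; simp
        refine ⟨p.coeff 0 / q.coeff 0, ?_⟩
        have ha : p.coeff 1 = 0 := by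
          rw [hc] at hdet
          simpa [hd] using hdet
        rw [eq_X_add_C_of_natDegree_le_one hq1, eq_X_add_C_of_natDegree_le_one hp1, ha, hc]
        simp [← map_mul, hd]
      · obtain ⟨e, he⟩ : ∃ e, p.coeff 1 = e * q.coeff 1 := ⟨_, (div_mul_cancel₀ _ hc).symm⟩
        refine ⟨e, ?_⟩
        have he0 : p.coeff 0 = e * q.coeff 0 :=
          mul_right_cancel₀ hc (by rw [he] at hdet; linear_combination -hdet)
        conv_lhs => rw [eq_X_add_C_of_natDegree_le_one hp1, he, he0]
        conv_rhs => rw [eq_X_add_C_of_natDegree_le_one hq1]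
        rw [map_mul, map_mul]
        ring
    have hue : u = algebraMap k K e := by
      rw [he, map_mul, aeval_C] at hu
      exact mul_right_cancel₀ (C.aeval_ne_zero hq) hu
    have hxe : C.x = algebraMap k K e := by
      rw [← σ.symm_apply_apply C.x, ← hudef, hue, AlgEquiv.commutes]
    exact C.aeval_ne_zero (X_sub_C_ne_zero e) (by simp [hxe])
  · rw [← eq_X_add_C_of_natDegree_le_one hp1, ← eq_X_add_C_of_natDegree_le_one hq1, hu]

lemma natDegree_le (C : HyperellipticCurve k K g) : C.F.natDegree ≤ 2 * g + 2 := by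
  rcases C.natDegree_eq with h | h <;> omega

/-- The branch form is semi-invariant, up to squares, under every automorphism. -/
lemma exists_homSubst_eq [CharZero k] (C : HyperellipticCurve k K g) (σ : K ≃ₐ[k] K)
    {P Q : k[X]} (hQ : Q ≠ 0) (h : σ C.x * aeval C.x Q = aeval C.x P) :
    ∃ w d e : k[X], d ≠ 0 ∧ e ≠ 0 ∧ homSubst (2 * g + 2) C.F P Q = C.F * w ∧
      d ^ 2 * w = e ^ 2 := by
  set w₀ : K := σ C.y * aeval C.x Q ^ (g + 1) with hw₀
  have hw2 : w₀ ^ 2 = aeval C.x (homSubst (2 * g + 2) C.F P Q) := by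
    rw [aeval_homSubst C.natDegree_le h, Polynomial.aeval_algHom_apply σ C.x C.F, ← C.equation,
      map_pow, hw₀]
    ring
  have hwmem : w₀ ∉ C.rationalSubfield := by
    intro hw
    have h1 : σ C.y ∈ C.rationalSubfield := by
      have h2 := div_mem hw (pow_mem (C.aeval_mem Q) (g + 1))
      rwa [hw₀, mul_div_cancel_right₀ _ (pow_ne_zero _ (C.aeval_ne_zero hQ))] at h2
    have h2 := C.apply_mem σ.symm h1
    rw [AlgEquiv.symm_apply_apply] at h2
    exact C.y_notMem h2
  obtain ⟨d, p, q, hd, hdw⟩ := C.exists_repr w₀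
  have hq : q ≠ 0 := by
    rintro rfl
    exact hwmem (C.mem_rationalSubfield_of_mul hd (by simpa using hdw))
  -- Squaring d·w₀ = p + q·y leaves the cross term 2pq·y. Since 1 and y are independent over k(x)
  -- and q ≠ 0, p vanishes.
  have hexp : aeval C.x (p ^ 2 + q ^ 2 * C.F - d ^ 2 * homSubst (2 * g + 2) C.F P Q)
      + aeval C.x (2 * p * q) * C.y = 0 := by
    simp only [map_add, map_mul, map_pow, map_sub, map_ofNat, ← C.equation, ← hw2]
    linear_combination (- aeval C.x d * w₀ - aeval C.x p - aeval C.x q * C.y) * hdw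
  obtain ⟨h1, h2⟩ := C.add_mul_y_eq_zero hexp
  have hp : p = 0 := by simpa [hq] using h2
  subst hp
  have h3 : d ^ 2 * homSubst (2 * g + 2) C.F P Q = q ^ 2 * C.F := by linear_combination -h1
  -- Once q and d are made coprime, the square of the new d divides the squarefree F, so it is a
  -- unit.
  obtain ⟨w, hw⟩ : C.F ∣ homSubst (2 * g + 2) C.F P Q := by
    classical
    have hg : EuclideanDomain.gcd q d ≠ 0 := fun h0 => hd (EuclideanDomain.gcd_eq_zero_iff.mp h0).2
    obtain ⟨q', h1⟩ := EuclideanDomain.gcd_dvd_left q d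
    obtain ⟨d', h2⟩ := EuclideanDomain.gcd_dvd_right q d
    have hco : IsCoprime q' d' := by
      refine ⟨EuclideanDomain.gcdA q d, EuclideanDomain.gcdB q d, mul_left_cancel₀ hg ?_⟩
      have := EuclideanDomain.gcd_eq_gcd_ab q d
      linear_combination (-1 : k[X]) * this - EuclideanDomain.gcdA q d * h1
        - EuclideanDomain.gcdB q d * h2
    have h' : q' ^ 2 * C.F = d' ^ 2 * homSubst (2 * g + 2) C.F P Q := by
      refine mul_left_cancel₀ (pow_ne_zero 2 hg) ?_
      rw [← mul_assoc, ← mul_assoc, ← mul_pow, ← mul_pow, ← h1, ← h2, h3]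
    have hdvd : d' * d' ∣ C.F := by
      rw [← pow_two]
      exact hco.symm.pow.dvd_of_dvd_mul_left (Dvd.intro _ h'.symm)
    exact (((C.squarefree d' hdvd).pow 2).dvd_mul_left).mp (Dvd.intro_left _ h')
  refine ⟨w, d, q, hd, hq, hw, mul_left_cancel₀ C.squarefree.ne_zero ?_⟩
  rw [hw] at h3
  linear_combination h3

/-- The roots of `F` are carried to roots of `F` by the Möbius transformation of an
automorphism. -/
lemma eval_moebius_eq_zero [CharZero k] (C : HyperellipticCurve k K g) (σ : K ≃ₐ[k] K)
    {P Q : k[X]} (h : σ C.x * aeval C.x Q = aeval C.x P) {p u : k} (hp : C.F.eval p = 0)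
    (hQ : Q.eval p ≠ 0) (hu : u * Q.eval p = P.eval p) : C.F.eval u = 0 := by
  obtain ⟨w, -, -, -, -, hw, -⟩ := C.exists_homSubst_eq σ (Q := Q) (by rintro rfl; simp at hQ) h
  have h1 := eval_homSubst C.natDegree_le hu
  rw [hw, eval_mul, hp, zero_mul] at h1
  exact (mul_eq_zero.mp h1.symm).resolve_right (pow_ne_zero _ hQ)

lemma homSubst_one_X {N : ℕ} {F : k[X]} (hF : F.natDegree ≤ N) :
    homSubst N F 1 X = reflect N F := by
  conv_rhs => rw [F.as_sum_range' (N + 1) (Nat.lt_succ_of_le hF)]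
  have hsum : ∀ (s : Finset ℕ) (f : ℕ → k[X]),
      reflect N (∑ j ∈ s, f j) = ∑ j ∈ s, reflect N (f j) := by
    intro s f
    classical
    induction s using Finset.induction_on with
    | empty => simp
    | insert a s ha ih => rw [Finset.sum_insert ha, Finset.sum_insert ha, reflect_add, ih]
  rw [homSubst, hsum]
  refine Finset.sum_congr rfl fun j hj => ?_
  rw [← C_mul_X_pow_eq_monomial, reflect_C_mul_X_pow,
    revAt_le (Nat.lt_succ_iff.mp (Finset.mem_range.mp hj)), one_pow, mul_one]

/-- If some automorphism inverts `x`, then `0` is a branch point precisely if `∞` is. -/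
lemma eval_zero_eq_zero_iff [CharZero k] (C : HyperellipticCurve k K g) (σ : K ≃ₐ[k] K)
    (h : σ C.x * C.x = 1) : C.F.eval 0 = 0 ↔ C.F.natDegree = 2 * g + 1 := by
  obtain ⟨w, d, e, hd, he, hw, hde⟩ := C.exists_homSubst_eq σ (P := 1) (Q := X) X_ne_zero
    (by simpa using h)
  rw [homSubst_one_X C.natDegree_le] at hw
  have hF := C.squarefree.ne_zero
  constructor
  · intro h0
    have h1 := congrArg (fun f => coeff f 0) hw
    simp only [coeff_reflect, revAt_zero, mul_coeff_zero] at h1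
    rw [coeff_zero_eq_eval_zero, h0, zero_mul] at h1
    refine C.natDegree_eq.resolve_right fun h2 => ?_
    rw [← h2, coeff_natDegree, leadingCoeff_eq_zero] at h1
    exact hF h1
  · intro h1
    by_contra h0
    -- Here deg F = 2g + 1 while its reflection has degree 2g + 2, so w has degree one. But d²w = e²
    -- forces the degree of w to be even.
    have h2 : (reflect (2 * g + 2) C.F).natDegree = 2 * g + 2 := by
      refine le_antisymm ?_ (le_natDegree_of_ne_zero ?_)
      · refine natDegree_reflect_le.trans (max_le le_rfl C.natDegree_le)
      · rw [coeff_reflect, revAt_le le_rfl, Nat.sub_self, coeff_zero_eq_eval_zero]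
        exact h0
    have hw0 : w ≠ 0 := by
      rintro rfl
      rw [mul_zero, reflect_eq_zero_iff] at hw
      exact hF hw
    have h3 := congrArg natDegree hde
    rw [natDegree_mul (pow_ne_zero _ hd) hw0, natDegree_pow, natDegree_pow] at h3
    rw [hw, natDegree_mul hF hw0] at h2
    omega

end Moebius

end HyperellipticCurve

/-! ### Changes of coordinate, automorphisms from equal equations, and the hyperelliptic involution.
-/

namespace HyperellipticCurve

section Coordinates

variable {k K : Type*} [Field k] [Field K] [Algebra k K] {g : ℕ}

lemma adjoin_eq_top_of_mem (C : HyperellipticCurve k K g) {s : Set K}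
    (hx : C.x ∈ IntermediateField.adjoin k s) (hy : C.y ∈ IntermediateField.adjoin k s) :
    IntermediateField.adjoin k s = ⊤ := by
  rw [eq_top_iff, ← C.adjoin_eq_top, IntermediateField.adjoin_le_iff]
  rintro z (rfl | rfl)
  · exact hx
  · exact hy

lemma squarefree_comp {F : k[X]} (hF : Squarefree F) {a : k} (ha : a ≠ 0) (b : k) :
    Squarefree (F.comp (Polynomial.C a * X + Polynomial.C b)) := by
  let : Invertible a := invertibleOfNonzero ha
  intro p hp
  rw [dvd_comp_C_mul_X_add_C_iff, mul_comp] at hp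
  have := hF _ hp
  have h2 : IsUnit ((algEquivCMulXAddC a b).symm p) := by
    simpa [← comp_eq_aeval] using this
  exact (MulEquiv.isUnit_map (algEquivCMulXAddC a b).symm).mp h2

/-- The curve in the coordinate `x'` with `x = a x' + b`. -/
noncomputable def affine (C : HyperellipticCurve k K g) (a b : k) (ha : a ≠ 0) :
    HyperellipticCurve k K g where
  F := C.F.comp (Polynomial.C a * X + Polynomial.C b)
  x := algebraMap k K a⁻¹ * (C.x - algebraMap k K b)
  y := C.y
  two_le_genus := C.two_le_genus
  squarefree := squarefree_comp C.squarefree ha b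
  natDegree_eq := by
    rw [natDegree_comp, natDegree_linear ha, mul_one]; exact C.natDegree_eq
  transcendental := by
    intro h
    apply C.transcendental
    have h1 := ((isAlgebraic_algebraMap (A := K) a).mul h).add (isAlgebraic_algebraMap (A := K) b)
    rwa [← mul_assoc, ← map_mul, mul_inv_cancel₀ ha, map_one, one_mul, sub_add_cancel] at h1
  equation := by
    rw [C.equation, aeval_comp]
    congr 1
    simp [ha]
  adjoin_eq_top := by
    refine C.adjoin_eq_top_of_mem ?_ ?_
    · set S := IntermediateField.adjoin k
        {algebraMap k K a⁻¹ * (C.x - algebraMap k K b), C.y}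
      have h : algebraMap k K a⁻¹ * (C.x - algebraMap k K b) ∈ S :=
        IntermediateField.subset_adjoin _ _ (by simp)
      have h1 := add_mem (mul_mem (S.algebraMap_mem a) h) (S.algebraMap_mem b)
      rwa [← mul_assoc, ← map_mul, mul_inv_cancel₀ ha, map_one, one_mul, sub_add_cancel] at h1
    · exact IntermediateField.subset_adjoin _ _ (by simp)

lemma affine_x (C : HyperellipticCurve k K g) (a b : k) (ha : a ≠ 0) :
    (C.affine a b ha).x = algebraMap k K a⁻¹ * (C.x - algebraMap k K b) := rfl

lemma affine_F (C : HyperellipticCurve k K g) (a b : k) (ha : a ≠ 0) :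
    (C.affine a b ha).F = C.F.comp (Polynomial.C a * X + Polynomial.C b) := rfl

/-- The curve with `y` scaled by a constant. -/
noncomputable def scale (C : HyperellipticCurve k K g) (e : k) (he : e ≠ 0) :
    HyperellipticCurve k K g where
  F := Polynomial.C (e ^ 2) * C.F
  x := C.x
  y := algebraMap k K e * C.y
  two_le_genus := C.two_le_genus
  squarefree := by
    intro p hp
    exact C.squarefree p
      ((isUnit_C.mpr (pow_ne_zero 2 he).isUnit).dvd_mul_left.mp hp)
  natDegree_eq := by
    rw [natDegree_C_mul (pow_ne_zero 2 he)]; exact C.natDegree_eq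
  transcendental := C.transcendental
  equation := by simp [mul_pow, C.equation]
  adjoin_eq_top := by
    refine C.adjoin_eq_top_of_mem (IntermediateField.subset_adjoin _ _ (by simp)) ?_
    set S := IntermediateField.adjoin k {C.x, algebraMap k K e * C.y}
    have h : algebraMap k K e * C.y ∈ S := IntermediateField.subset_adjoin _ _ (by simp)
    have h1 := mul_mem (S.algebraMap_mem e⁻¹) h
    rwa [← mul_assoc, ← map_mul, inv_mul_cancel₀ he, map_one, one_mul] at h1

lemma scale_x (C : HyperellipticCurve k K g) (e : k) (he : e ≠ 0) :
    (C.scale e he).x = C.x := rfl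

lemma scale_y (C : HyperellipticCurve k K g) (e : k) (he : e ≠ 0) :
    (C.scale e he).y = algebraMap k K e * C.y := rfl

lemma scale_F (C : HyperellipticCurve k K g) (e : k) (he : e ≠ 0) :
    (C.scale e he).F = Polynomial.C (e ^ 2) * C.F := rfl

/-- Reflection is multiplicative, so a square factor p² of the reflection reflects to a square
factor of F. Hence p = cXⁿ, and n > 0 would lower the degree of F by two below N, against `hdeg`. -/
lemma squarefree_reflect {N : ℕ} {F : k[X]} (hF : Squarefree F) (hdeg : N ≤ F.natDegree + 1)
    (hN : F.natDegree ≤ N) : Squarefree (reflect N F) := by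
  intro p hp
  have hF0 := hF.ne_zero
  obtain ⟨q, hq⟩ := hp
  have hne : reflect N F ≠ 0 := by rwa [Ne, reflect_eq_zero_iff]
  have hp0 : p ≠ 0 := by rintro rfl; simp at hq; exact hF0 hq
  have hq0 : q ≠ 0 := by rintro rfl; simp at hq; exact hF0 hq
  set n := p.natDegree with hn
  have hpp : (p * p).natDegree = n + n := natDegree_mul hp0 hp0
  have hle : n + n + q.natDegree ≤ N := by
    rw [← hpp, ← natDegree_mul (mul_ne_zero hp0 hp0) hq0, ← hq]
    exact natDegree_reflect_le.trans (max_le le_rfl hN)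
  obtain ⟨m, rfl⟩ := Nat.exists_eq_add_of_le (le_of_add_le_left hle)
  have hF' : F = reflect n p * reflect n p * reflect m q := by
    rw [← reflect_mul p p le_rfl le_rfl, ← reflect_mul (p * p) q hpp.le (by omega), ← hq,
      reflect_reflect]
  have hu := hF _ (Dvd.intro _ hF'.symm)
  obtain ⟨c, hc, hcp⟩ := Polynomial.isUnit_iff.mp hu
  have hp' : p = Polynomial.C c * X ^ n := by
    rw [← reflect_reflect (N := n) (p := p), ← hcp, reflect_C]
  have hn0 : n = 0 := by
    by_contra hn0
    have h1 : F.natDegree = (reflect m q).natDegree := by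
      rw [hF', ← hcp, ← map_mul, natDegree_C_mul (mul_ne_zero hc.ne_zero hc.ne_zero)]
    have h2 : (reflect m q).natDegree ≤ m :=
      natDegree_reflect_le.trans (max_le le_rfl (by omega))
    omega
  rw [hp', hn0, pow_zero, mul_one]
  exact hc.map _

/-- The curve in the coordinate `1 / x`. -/
noncomputable def inversion (C : HyperellipticCurve k K g) : HyperellipticCurve k K g where
  F := reflect (2 * g + 2) C.F
  x := C.x⁻¹
  y := C.y * C.x⁻¹ ^ (g + 1)
  two_le_genus := C.two_le_genus
  squarefree := squarefree_reflect C.squarefree (by rcases C.natDegree_eq with h | h <;> omega)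
    C.natDegree_le
  natDegree_eq := by
    have h1 : (reflect (2 * g + 2) C.F).natDegree ≤ 2 * g + 2 :=
      natDegree_reflect_le.trans (max_le le_rfl C.natDegree_le)
    by_contra! h
    have h2 : (reflect (2 * g + 2) C.F).natDegree < 2 * g + 1 := by omega
    have h3 : C.F.coeff 0 = 0 := by
      have := coeff_eq_zero_of_natDegree_lt (h2.trans (Nat.lt_succ_self _))
      rwa [coeff_reflect, revAt_le (by omega), Nat.sub_self] at this
    have h4 : C.F.coeff 1 = 0 := by
      have := coeff_eq_zero_of_natDegree_lt h2
      rwa [coeff_reflect, revAt_le (by omega), show 2 * g + 2 - (2 * g + 1) = 1 by omega] at this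
    have h5 : X ^ 2 ∣ C.F := by
      rw [X_pow_dvd_iff]
      intro d hd
      interval_cases d <;> assumption
    rw [pow_two] at h5
    exact not_isUnit_X (C.squarefree _ h5)
  transcendental := fun h => C.transcendental (by simpa using h.inv)
  equation := by
    have hx : C.x ≠ 0 := by
      intro h0
      exact C.aeval_ne_zero X_ne_zero (by simpa using h0)
    rw [← homSubst_one_X C.natDegree_le,
      aeval_homSubst (u := C.x) C.natDegree_le (by simp [hx]), mul_pow, C.equation, aeval_X]
    ring
  adjoin_eq_top := by
    set S := IntermediateField.adjoin k {C.x⁻¹, C.y * C.x⁻¹ ^ (g + 1)}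
    have hx : C.x ≠ 0 := by
      intro h0
      exact C.aeval_ne_zero X_ne_zero (by simpa using h0)
    have h1 : C.x⁻¹ ∈ S := IntermediateField.subset_adjoin _ _ (by simp)
    have h2 : C.y * C.x⁻¹ ^ (g + 1) ∈ S := IntermediateField.subset_adjoin _ _ (by simp)
    have h3 : C.x ∈ S := by simpa using inv_mem h1
    refine C.adjoin_eq_top_of_mem h3 ?_
    have h4 := mul_mem h2 (pow_mem h3 (g + 1))
    rwa [mul_assoc, ← mul_pow, inv_mul_cancel₀ hx, one_pow, mul_one] at h4

lemma inversion_x (C : HyperellipticCurve k K g) : C.inversion.x = C.x⁻¹ := rfl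

lemma algHom_ext [CharZero k] (C : HyperellipticCurve k K g) {σ τ : K →ₐ[k] K}
    (hx : σ C.x = τ C.x) (hy : σ C.y = τ C.y) : σ = τ := by
  ext z
  obtain ⟨d, p, q, hd, h⟩ := C.exists_repr z
  have key : ∀ f : k[X], σ (aeval C.x f) = τ (aeval C.x f) := fun f => by
    rw [← Polynomial.aeval_algHom_apply, ← Polynomial.aeval_algHom_apply, hx]
  refine mul_left_cancel₀ ((map_ne_zero σ).mpr (C.aeval_ne_zero hd)) ?_
  have h1 := congrArg σ h
  have h2 := congrArg τ h
  simp only [map_mul, map_add] at h1 h2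
  rw [h1, key d, h2, key p, key q, hy]

lemma algEquiv_ext [CharZero k] (C : HyperellipticCurve k K g) {σ τ : K ≃ₐ[k] K}
    (hx : σ C.x = τ C.x) (hy : σ C.y = τ C.y) : σ = τ := by
  have := C.algHom_ext (σ := (σ : K →ₐ[k] K)) (τ := (τ : K →ₐ[k] K)) hx hy
  ext z
  exact DFunLike.congr_fun this z

/-- The remainder has degree at most one in Y, and 1, y are independent over k(x). So the ideal of
relations between x and y depends on F alone, which is what `exists_algHom` needs. -/
lemma aevalAeval_eq_zero_iff (C : HyperellipticCurve k K g) (Q : k[X][X]) :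
    aevalAeval C.x C.y Q = 0 ↔ Q %ₘ (X ^ 2 - Polynomial.C C.F) = 0 := by
  have hm : (X ^ 2 - Polynomial.C C.F : k[X][X]).Monic := monic_X_pow_sub_C C.F two_ne_zero
  have hP0 : aevalAeval C.x C.y (X ^ 2 - Polynomial.C C.F) = 0 := by
    rw [map_sub, map_pow, aevalAeval_C, aevalAeval_Y, C.equation, sub_self]
  have h1 : aevalAeval C.x C.y Q = aevalAeval C.x C.y (Q %ₘ (X ^ 2 - Polynomial.C C.F)) := by
    conv_lhs => rw [← modByMonic_add_div Q (X ^ 2 - Polynomial.C C.F)]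
    rw [map_add, map_mul, hP0, zero_mul, add_zero]
  rw [h1]
  refine ⟨fun h => ?_, fun h => by rw [h, map_zero]⟩
  have hdeg : (Q %ₘ (X ^ 2 - Polynomial.C C.F)).natDegree ≤ 1 := by
    have := natDegree_modByMonic_lt Q hm (by
      intro h
      have := congrArg natDegree h
      rw [natDegree_X_pow_sub_C, natDegree_one] at this
      omega)
    rw [natDegree_X_pow_sub_C] at this
    omega
  rw [eq_X_add_C_of_natDegree_le_one hdeg] at h ⊢
  rw [map_add, map_mul, aevalAeval_C, aevalAeval_C, aevalAeval_Y, add_comm] at h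
  obtain ⟨h2, h3⟩ := C.add_mul_y_eq_zero h
  rw [h2, h3]; simp

/-- The hypothesis `hsurj` makes K the fraction field of A through ψ₁, so ψ₂ extends to K. -/
lemma exists_algHom_extension {A : Type*} [CommRing A] [Algebra k A] (ψ₁ ψ₂ : A →ₐ[k] K)
    (hinj₁ : Function.Injective ψ₁) (hinj₂ : Function.Injective ψ₂)
    (hsurj : ∀ z : K, ∃ a b : A, z = ψ₁ a / ψ₁ b) :
    ∃ f : K →ₐ[k] K, ∀ a, f (ψ₁ a) = ψ₂ a := by
  let : Algebra A K := ψ₁.toRingHom.toAlgebra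
  have : IsScalarTower k A K := IsScalarTower.of_algebraMap_eq fun c => (ψ₁.commutes c).symm
  have : FaithfulSMul A K := (faithfulSMul_iff_algebraMap_injective A K).mpr hinj₁
  have : IsFractionRing A K := IsFractionRing.of_field A K hsurj
  exact ⟨IsFractionRing.liftAlgHom hinj₂, fun a => IsFractionRing.lift_algebraMap hinj₂ a⟩

lemma exists_algHom [CharZero k] (C₁ C₂ : HyperellipticCurve k K g) (hF : C₁.F = C₂.F) :
    ∃ f : K →ₐ[k] K, f C₁.x = C₂.x ∧ f C₁.y = C₂.y := by
  let φ₁ : k[X][X] →ₐ[k] K := aevalAeval C₁.x C₁.y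
  let φ₂ : k[X][X] →ₐ[k] K := aevalAeval C₂.x C₂.y
  have hker : ∀ Q, φ₁ Q = 0 ↔ φ₂ Q = 0 := fun Q => by
    rw [C₁.aevalAeval_eq_zero_iff, C₂.aevalAeval_eq_zero_iff, hF]
  let A := k[X][X] ⧸ RingHom.ker φ₁
  let ψ₁ : A →ₐ[k] K := Ideal.Quotient.liftₐ _ φ₁ fun a ha => ha
  let ψ₂ : A →ₐ[k] K := Ideal.Quotient.liftₐ _ φ₂ fun a ha => (hker a).mp ha
  have hψ₁ : ∀ Q : k[X][X], ψ₁ (Ideal.Quotient.mk (RingHom.ker φ₁) Q) = φ₁ Q := fun Q => rfl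
  have hψ₂ : ∀ Q : k[X][X], ψ₂ (Ideal.Quotient.mk (RingHom.ker φ₁) Q) = φ₂ Q := fun Q => rfl
  have hinj₁ : Function.Injective ψ₁ := by
    rw [injective_iff_map_eq_zero]
    intro a ha
    obtain ⟨Q, rfl⟩ := Ideal.Quotient.mk_surjective a
    exact Ideal.Quotient.eq_zero_iff_mem.mpr ha
  have hinj₂ : Function.Injective ψ₂ := by
    rw [injective_iff_map_eq_zero]
    intro a ha
    obtain ⟨Q, rfl⟩ := Ideal.Quotient.mk_surjective a
    exact Ideal.Quotient.eq_zero_iff_mem.mpr ((hker Q).mpr ha)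
  have hsurj : ∀ z : K, ∃ a b : A, z = ψ₁ a / ψ₁ b := by
    intro z
    obtain ⟨d, p, q, hd, h⟩ := C₁.exists_repr z
    refine ⟨Ideal.Quotient.mk (RingHom.ker φ₁) (Polynomial.C p + Polynomial.C q * X),
      Ideal.Quotient.mk (RingHom.ker φ₁) (Polynomial.C d), ?_⟩
    rw [hψ₁, hψ₁]
    simp only [φ₁, map_add, map_mul, aevalAeval_C, aevalAeval_Y]
    rw [eq_div_iff (C₁.aeval_ne_zero hd), mul_comm, h]
  obtain ⟨f, hf⟩ := exists_algHom_extension (A := A) ψ₁ ψ₂ hinj₁ hinj₂ hsurj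
  refine ⟨f, ?_, ?_⟩
  · simpa [hψ₁, hψ₂, φ₁, φ₂] using hf (Ideal.Quotient.mk (RingHom.ker φ₁) (Polynomial.C X))
  · simpa [hψ₁, hψ₂, φ₁, φ₂] using hf (Ideal.Quotient.mk (RingHom.ker φ₁) X)

/-- Two presentations of `K` by the same polynomial differ by an automorphism. -/
lemma exists_algEquiv [CharZero k] (C₁ C₂ : HyperellipticCurve k K g) (hF : C₁.F = C₂.F) :
    ∃ σ : K ≃ₐ[k] K, σ C₁.x = C₂.x ∧ σ C₁.y = C₂.y := by
  obtain ⟨f, hfx, hfy⟩ := C₁.exists_algHom C₂ hF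
  obtain ⟨f', hfx', hfy'⟩ := C₂.exists_algHom C₁ hF.symm
  refine ⟨AlgEquiv.ofAlgHom f f' (C₂.algHom_ext ?_ ?_) (C₁.algHom_ext ?_ ?_), hfx, hfy⟩ <;>
    simp [*]

lemma mem_hyperellipticSubgroup_iff (C : HyperellipticCurve k K g) (σ : K ≃ₐ[k] K) :
    σ ∈ C.hyperellipticSubgroup ↔ σ C.x = C.x := by
  rw [hyperellipticSubgroup, IntermediateField.mem_fixingSubgroup_iff]
  refine ⟨fun h => h _ (IntermediateField.mem_adjoin_simple_self k C.x), fun h z hz => ?_⟩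
  obtain ⟨p, q, rfl⟩ := (IntermediateField.mem_adjoin_simple_iff k z).mp hz
  rw [map_div₀, ← Polynomial.aeval_algHom_apply σ,
    ← Polynomial.aeval_algHom_apply σ, h]

lemma apply_eq_of_mem (C : HyperellipticCurve k K g) {σ : K ≃ₐ[k] K}
    (hσ : σ ∈ C.hyperellipticSubgroup) {z : K} (hz : z ∈ C.rationalSubfield) : σ z = z :=
  (IntermediateField.mem_fixingSubgroup_iff _ σ).mp hσ z hz

lemma y_ne_zero (C : HyperellipticCurve k K g) : C.y ≠ 0 := fun h =>
  C.y_notMem (h ▸ zero_mem _)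

/-- The hyperelliptic involution generates `Gal(K / k(x))`. -/
lemma exists_involution [CharZero k] (C : HyperellipticCurve k K g) :
    ∃ ι : K ≃ₐ[k] K, ι C.y = -C.y ∧ ι ≠ 1 ∧ ∀ σ, σ ∈ C.hyperellipticSubgroup ↔ σ = 1 ∨ σ = ι := by
  have : CharZero K := charZero_of_injective_algebraMap (algebraMap k K).injective
  -- Scaling y by -1 does not change F, so the two presentations differ by an automorphism.
  obtain ⟨ι, hx, hy⟩ := C.exists_algEquiv (C.scale (-1) (neg_ne_zero.mpr one_ne_zero))
    (by simp [scale_F])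
  rw [scale_x] at hx
  rw [scale_y, map_neg, map_one, neg_one_mul] at hy
  refine ⟨ι, hy, ?_, fun σ => ?_⟩
  · rintro rfl
    rw [AlgEquiv.one_apply] at hy
    exact C.y_ne_zero (self_eq_neg.mp hy)
  · rw [mem_hyperellipticSubgroup_iff]
    constructor
    · intro hσ
      have h1 : σ C.y ^ 2 = C.y ^ 2 := by
        rw [← map_pow, C.equation, ← Polynomial.aeval_algHom_apply σ, hσ]
      rcases sq_eq_sq_iff_eq_or_eq_neg.mp h1 with h | h
      · exact Or.inl (C.algEquiv_ext hσ h)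
      · exact Or.inr (C.algEquiv_ext (hσ.trans hx.symm) (h.trans hy.symm))
    · rintro (rfl | rfl)
      · rfl
      · exact hx

end Coordinates

end HyperellipticCurve

/-! ### Groups of order 24 with the tetrahedral relations. -/

/-- The relations between lifts `I, J, T` of generators of the tetrahedral group to a central
extension by an involution `z`; the parity of `n` distinguishes the two extensions. -/
structure TetrahedralRelations {G : Type*} [Group G] (n : ℕ) (I J T z : G) : Prop where
  z_mul_self : z * z = 1
  central : ∀ x, z * x = x * z
  I_mul_self : I * I = z ^ n
  J_mul_self : J * J = z ^ n
  J_mul_I : J * I = z ^ n * (I * J)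
  T_mul_I : T * I = J * T
  T_mul_J : T * J = I * J * T
  T_pow_three : T ^ 3 = 1

namespace TetrahedralRelations

/-- The property of having a normal form `zᶜ Iᵃ Jᵇ Tᵈ`. -/
def HasNormalForm {G : Type*} [Group G] (I J T z x : G) : Prop :=
  ∃ c a b d : ℕ, x = z ^ c * I ^ a * J ^ b * T ^ d

section NormalForm

variable {G : Type*} [Group G] {n : ℕ} {I J T z : G}

lemma central_pow (h : TetrahedralRelations n I J T z) (c : ℕ) (x : G) :
    z ^ c * x = x * z ^ c :=
  (show Commute z x from h.central x).pow_left c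

/-- Left multiplication by each of z, I, J, T preserves normal forms. Hence they are closed under
products, with no need for inverses. -/
lemma z_mul (_ : TetrahedralRelations n I J T z) {x : G} (hx : HasNormalForm I J T z x) :
    HasNormalForm I J T z (z * x) := by
  obtain ⟨c, a, b, d, rfl⟩ := hx
  exact ⟨c + 1, a, b, d, by simp only [pow_succ', mul_assoc]⟩

lemma I_mul (h : TetrahedralRelations n I J T z) {x : G} (hx : HasNormalForm I J T z x) :
    HasNormalForm I J T z (I * x) := by
  obtain ⟨c, a, b, d, rfl⟩ := hx
  refine ⟨c, a + 1, b, d, ?_⟩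
  rw [pow_succ' I]
  simp only [← mul_assoc]
  rw [h.central_pow c I]

lemma J_mul_I_pow (h : TetrahedralRelations n I J T z) (a : ℕ) :
    J * I ^ a = z ^ (n * a) * I ^ a * J := by
  induction a with
  | zero => simp
  | succ a ih =>
    rw [pow_succ, ← mul_assoc, ih, mul_assoc _ J I, h.J_mul_I, ← mul_assoc, mul_assoc _ _ (z ^ n),
      ← h.central_pow n, Nat.mul_succ, pow_add]
    simp only [mul_assoc]

lemma J_mul (h : TetrahedralRelations n I J T z) {x : G} (hx : HasNormalForm I J T z x) :
    HasNormalForm I J T z (J * x) := by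
  obtain ⟨c, a, b, d, rfl⟩ := hx
  refine ⟨c + n * a, a, b + 1, d, ?_⟩
  have : J * (z ^ c * I ^ a * J ^ b * T ^ d) = z ^ c * (J * I ^ a) * J ^ b * T ^ d := by
    simp only [← mul_assoc]
    rw [h.central_pow c J]
  rw [this, h.J_mul_I_pow, pow_add, pow_succ']
  simp only [mul_assoc]

lemma T_mul_I_pow (h : TetrahedralRelations n I J T z) (a : ℕ) : T * I ^ a = J ^ a * T :=
  (show SemiconjBy T I J from h.T_mul_I).pow_right a

lemma T_mul_J_pow (h : TetrahedralRelations n I J T z) (a : ℕ) : T * J ^ a = (I * J) ^ a * T :=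
  (show SemiconjBy T J (I * J) from h.T_mul_J).pow_right a

lemma pow_mul_of {P : G → Prop} {y : G} (h : ∀ x, P x → P (y * x)) (a : ℕ) :
    ∀ x, P x → P (y ^ a * x) := by
  induction a with
  | zero => simp
  | succ a ih => intro x hx; rw [pow_succ, mul_assoc]; exact ih _ (h _ hx)

lemma T_mul (h : TetrahedralRelations n I J T z) {x : G} (hx : HasNormalForm I J T z x) :
    HasNormalForm I J T z (T * x) := by
  obtain ⟨c, a, b, d, rfl⟩ := hx
  have : T * (z ^ c * I ^ a * J ^ b * T ^ d) = z ^ c * (J ^ a * ((I * J) ^ b * T ^ (d + 1))) := by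
    simp only [← mul_assoc]
    rw [← h.central_pow c T, mul_assoc _ T, h.T_mul_I_pow, ← mul_assoc, mul_assoc _ T,
      h.T_mul_J_pow, pow_succ' T]
    simp only [mul_assoc]
  rw [this]
  refine pow_mul_of (P := HasNormalForm I J T z) (fun _ => h.z_mul) _ _ (pow_mul_of (P := HasNormalForm I J T z) (fun _ => h.J_mul) _ _
    (pow_mul_of (P := HasNormalForm I J T z) (fun x hx => ?_) _ _ ⟨0, 0, 0, d + 1, by simp⟩))
  rw [mul_assoc]
  exact h.I_mul (h.J_mul hx)

lemma mul (h : TetrahedralRelations n I J T z) {x y : G} (hx : HasNormalForm I J T z x)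
    (hy : HasNormalForm I J T z y) : HasNormalForm I J T z (x * y) := by
  obtain ⟨c, a, b, d, rfl⟩ := hx
  rw [mul_assoc, mul_assoc, mul_assoc]
  exact pow_mul_of (P := HasNormalForm I J T z) (fun _ => h.z_mul) _ _ (pow_mul_of (P := HasNormalForm I J T z) (fun _ => h.I_mul) _ _
    (pow_mul_of (P := HasNormalForm I J T z) (fun _ => h.J_mul) _ _ (pow_mul_of (P := HasNormalForm I J T z) (fun _ => h.T_mul) _ _ hy)))

lemma exists_bounded (h : TetrahedralRelations n I J T z) {x : G}
    (hx : HasNormalForm I J T z x) : ∃ m : Fin 2 × Fin 2 × Fin 2 × Fin 3,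
      x = z ^ (m.1 : ℕ) * I ^ (m.2.1 : ℕ) * J ^ (m.2.2.1 : ℕ) * T ^ (m.2.2.2 : ℕ) := by
  obtain ⟨c, a, b, d, rfl⟩ := hx
  have hI : I ^ a = z ^ (n * (a / 2)) * I ^ (a % 2) := by
    conv_lhs => rw [← Nat.div_add_mod a 2, pow_add, pow_mul, pow_two, h.I_mul_self, ← pow_mul]
  have hJ : J ^ b = z ^ (n * (b / 2)) * J ^ (b % 2) := by
    conv_lhs => rw [← Nat.div_add_mod b 2, pow_add, pow_mul, pow_two, h.J_mul_self, ← pow_mul]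
  have hT : T ^ d = T ^ (d % 3) := by
    conv_lhs => rw [← Nat.div_add_mod d 3, pow_add, pow_mul, h.T_pow_three, one_pow, one_mul]
  have hz : ∀ c : ℕ, z ^ c = z ^ (c % 2) := fun c => by
    conv_lhs => rw [← Nat.div_add_mod c 2, pow_add, pow_mul, pow_two, h.z_mul_self, one_pow,
      one_mul]
  refine ⟨⟨⟨(c + n * (a / 2) + n * (b / 2)) % 2, Nat.mod_lt _ (by norm_num)⟩,
    ⟨a % 2, Nat.mod_lt _ (by norm_num)⟩, ⟨b % 2, Nat.mod_lt _ (by norm_num)⟩,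
    ⟨d % 3, Nat.mod_lt _ (by norm_num)⟩⟩, ?_⟩
  change _ = z ^ ((c + n * (a / 2) + n * (b / 2)) % 2) * I ^ (a % 2) * J ^ (b % 2) * T ^ (d % 3)
  rw [← hz, hI, hJ, ← hT, pow_add, pow_add]
  congr 1
  simp only [← mul_assoc]
  rw [mul_assoc _ (I ^ (a % 2)), ← h.central_pow _ (I ^ (a % 2))]
  simp only [← mul_assoc]

end NormalForm

variable {A B : Type*} [Group A] {n : ℕ} {I J T z : A}

lemma prod [Group B] {I' J' T' z' : B} (hA : TetrahedralRelations n I J T z) (hB : TetrahedralRelations n I' J' T' z') :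
    TetrahedralRelations n (I, I') (J, J') (T, T') (z, z') where
  z_mul_self := Prod.ext hA.z_mul_self hB.z_mul_self
  central x := Prod.ext (hA.central x.1) (hB.central x.2)
  I_mul_self := Prod.ext hA.I_mul_self hB.I_mul_self
  J_mul_self := Prod.ext hA.J_mul_self hB.J_mul_self
  J_mul_I := Prod.ext hA.J_mul_I hB.J_mul_I
  T_mul_I := Prod.ext hA.T_mul_I hB.T_mul_I
  T_mul_J := Prod.ext hA.T_mul_J hB.T_mul_J
  T_pow_three := Prod.ext hA.T_pow_three hB.T_pow_three

/-- The submonoid of elements with a normal form. -/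
def normalForms (h : TetrahedralRelations n I J T z) : Submonoid A where
  carrier := {x | HasNormalForm I J T z x}
  one_mem' := ⟨0, 0, 0, 0, by simp⟩
  mul_mem' := h.mul

/-- The relations reduce the exponents of z, I, J modulo 2 and that of T modulo 3, leaving 2·2·2·3 =
24 words. -/
lemma card_normalForms_le (h : TetrahedralRelations n I J T z) :
    Finite h.normalForms ∧ Nat.card h.normalForms ≤ 24 := by
  have hinj : Function.Injective (fun x : h.normalForms => (h.exists_bounded x.2).choose) := by
    intro x y hxy
    have hx := (h.exists_bounded x.2).choose_spec
    have hy := (h.exists_bounded y.2).choose_spec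
    dsimp only at hxy
    rw [← hxy] at hy
    exact Subtype.ext (hx.trans hy.symm)
  refine ⟨Finite.of_injective _ hinj, ?_⟩
  have := Nat.card_le_card_of_injective _ hinj
  simpa using this

lemma bijective_of_surjective {h : TetrahedralRelations n I J T z} {f : h.normalForms → B}
    (hB : Nat.card B = 24) (hf : Function.Surjective f) : Function.Bijective f := by
  obtain ⟨hfin, hcard⟩ := h.card_normalForms_le
  refine (Nat.bijective_iff_surjective_and_card f).mpr ⟨hf, le_antisymm (by omega) ?_⟩
  exact Nat.card_le_card_of_surjective f hf

/-- Two groups of order `24` with the same relations are isomorphic. -/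
theorem nonempty_mulEquiv [Group B] {I' J' T' z' : B} (hA : TetrahedralRelations n I J T z)
    (hB : TetrahedralRelations n I' J' T' z') (hA' : ∀ x, HasNormalForm I J T z x)
    (hB' : ∀ x, HasNormalForm I' J' T' z' x) (cardA : Nat.card A = 24)
    (cardB : Nat.card B = 24) : Nonempty (A ≃* B) := by
  -- The words in the paired generators form a submonoid of A × B with at most 24 elements. It
  -- projects onto both factors, each of order 24, so both projections are bijective and it is the
  -- graph of an isomorphism.
  let f : (hA.prod hB).normalForms →* A := (MonoidHom.fst A B).comp (Submonoid.subtype _)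
  let f' : (hA.prod hB).normalForms →* B := (MonoidHom.snd A B).comp (Submonoid.subtype _)
  have hf : Function.Bijective f := by
    refine bijective_of_surjective cardA fun x => ?_
    obtain ⟨c, a, b, d, rfl⟩ := hA' x
    exact ⟨⟨_, c, a, b, d, rfl⟩, rfl⟩
  have hf' : Function.Bijective f' := by
    refine bijective_of_surjective cardB fun x => ?_
    obtain ⟨c, a, b, d, rfl⟩ := hB' x
    exact ⟨⟨_, c, a, b, d, rfl⟩, rfl⟩
  exact ⟨(MulEquiv.ofBijective f hf).symm.trans (MulEquiv.ofBijective f' hf')⟩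

end TetrahedralRelations

/-! ### The concrete groups A₄, Z₂ × A₄ and SL₂(3). -/

section Models

open Equiv

/-- The double transposition `(0 1)(2 3)`. -/
def tetI : alternatingGroup (Fin 4) := ⟨swap 0 1 * swap 2 3, Perm.mem_alternatingGroup.mpr (by decide)⟩

/-- The double transposition `(0 2)(1 3)`. -/
def tetJ : alternatingGroup (Fin 4) := ⟨swap 0 2 * swap 1 3, Perm.mem_alternatingGroup.mpr (by decide)⟩

/-- The three-cycle `(1 2 3)`. -/
def tetT : alternatingGroup (Fin 4) := ⟨swap 1 2 * swap 2 3, Perm.mem_alternatingGroup.mpr (by decide)⟩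

lemma tet_relations : tetI ≠ 1 ∧ tetJ ≠ 1 ∧ tetI * tetJ ≠ 1 ∧ tetI * tetI = 1 ∧
    tetT * tetI = tetJ * tetT ∧ tetT * tetJ = tetI * tetJ * tetT ∧ tetT ^ 3 = 1 := by
  decide

set_option maxRecDepth 100000 in
lemma tet_surjective : ∀ x : alternatingGroup (Fin 4), ∃ a b : Fin 2, ∃ d : Fin 3,
    x = tetI ^ (a : ℕ) * tetJ ^ (b : ℕ) * tetT ^ (d : ℕ) := by
  decide

-- The element orders in A₄ are 1, 2 and 3. This excludes X ↦ iX, which has order four, from the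
-- reduced group.
set_option maxRecDepth 100000 in
lemma alternatingGroup_four_pow_six : ∀ x : alternatingGroup (Fin 4), x ^ 6 = 1 := by
  decide

/-- A generator of `SL₂(3)` of order four. -/
def slI : Matrix.SpecialLinearGroup (Fin 2) (ZMod 3) := ⟨!![0, -1; 1, 0], by decide⟩

/-- A generator of `SL₂(3)` of order four. -/
def slJ : Matrix.SpecialLinearGroup (Fin 2) (ZMod 3) := ⟨!![1, 1; 1, -1], by decide⟩

/-- A transvection, of order three in `SL₂(3)`. -/
def slT : Matrix.SpecialLinearGroup (Fin 2) (ZMod 3) := ⟨!![1, 1; 0, 1], by decide⟩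

lemma specialLinearGroup_surjective :
    ∀ x : Matrix.SpecialLinearGroup (Fin 2) (ZMod 3), ∃ c a b : Fin 2, ∃ d : Fin 3,
      x = (-1) ^ (c : ℕ) * slI ^ (a : ℕ) * slJ ^ (b : ℕ) * slT ^ (d : ℕ) := by
  decide +kernel

/-- `SL₂(3)` satisfies the tetrahedral relations with nonsplit double transpositions. -/
lemma specialLinearGroup_relations : TetrahedralRelations 1 slI slJ slT (-1) ∧
    ∀ x, TetrahedralRelations.HasNormalForm slI slJ slT (-1) x := by
  refine ⟨⟨by decide, fun x => by simp, by decide, by decide, by decide,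
      by decide, by decide, by decide⟩, fun x => ?_⟩
  obtain ⟨c, a, b, d, h⟩ := specialLinearGroup_surjective x
  exact ⟨c, a, b, d, h⟩

lemma card_specialLinearGroup :
    Nat.card (Matrix.SpecialLinearGroup (Fin 2) (ZMod 3)) = 24 := by
  rw [Nat.card_eq_fintype_card]
  decide +kernel

lemma product_relations :
    TetrahedralRelations 0 ((1, tetI) : Multiplicative (ZMod 2) × alternatingGroup (Fin 4))
      (1, tetJ) (1, tetT) (Multiplicative.ofAdd 1, 1) ∧
      ∀ x, TetrahedralRelations.HasNormalForm
        ((1, tetI) : Multiplicative (ZMod 2) × alternatingGroup (Fin 4))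
        (1, tetJ) (1, tetT) (Multiplicative.ofAdd 1, 1) x := by
  refine ⟨⟨by decide, fun x => ?_, by decide, by decide, by decide, by decide, by decide,
    by decide⟩, fun x => ?_⟩
  · exact Prod.ext (mul_comm _ _) (by simp)
  · obtain ⟨a, b, d, h⟩ := tet_surjective x.2
    have hz : ∀ y : Multiplicative (ZMod 2), ∃ c : ℕ, y = Multiplicative.ofAdd 1 ^ c :=
      fun y => ⟨y.toAdd.val, by rw [← ofAdd_nsmul]; simp⟩
    obtain ⟨c, hc⟩ := hz x.1
    exact ⟨c, a, b, d, Prod.ext (by simpa using hc) (by simpa using h)⟩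

end Models

/-! ### Central extensions of A₄ by a group of order two. -/

section Extension

variable {G : Type*} [Group G]

open TetrahedralRelations

/-- A central extension of `A₄` by a group `{1, z}` of order two satisfies the tetrahedral
relations. -/
theorem exists_tetrahedralRelations (N : Subgroup G) [N.Normal] (e : G ⧸ N ≃* alternatingGroup (Fin 4))
    {z : G} (hz : z ≠ 1) (hN : ∀ x, x ∈ N ↔ x = 1 ∨ x = z) :
    ∃ (n : ℕ) (I J T : G), n < 2 ∧ TetrahedralRelations n I J T z ∧
      (∀ x, HasNormalForm I J T z x) ∧ I ∉ N ∧ J ∉ N ∧ I * J ∉ N ∧ Nat.card G = 24 := by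
  have hzN : z ∈ N := (hN z).mpr (Or.inr rfl)
  have hzz : z * z = 1 := ((hN _).mp (mul_mem hzN hzN)).resolve_right
    (fun h => hz (by simpa using h))
  have hcent : ∀ x, z * x = x * z := by
    intro x
    rcases (hN _).mp (Subgroup.Normal.conj_mem inferInstance z hzN x) with h | h
    · exact absurd (by simpa using h) hz
    · rw [mul_inv_eq_iff_eq_mul] at h; exact h.symm
  let π : G →* alternatingGroup (Fin 4) := e.toMonoidHom.comp (QuotientGroup.mk' N)
  have hπ : Function.Surjective π := e.surjective.comp (QuotientGroup.mk'_surjective N)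
  have hker : ∀ x, π x = 1 ↔ x = 1 ∨ x = z := by
    intro x
    rw [← hN, ← QuotientGroup.eq_one_iff x]
    exact e.map_eq_one_iff
  have hker2 : ∀ x y, π x = π y → x = y ∨ x = z * y := by
    intro x y h
    have : π (x * y⁻¹) = 1 := by rw [map_mul, h, map_inv, mul_inv_cancel]
    rcases (hker _).mp this with h | h
    · exact Or.inl (mul_inv_eq_one.mp h)
    · exact Or.inr (mul_inv_eq_iff_eq_mul.mp h)
  have hπz : π z = 1 := (hker z).mpr (Or.inr rfl)
  obtain ⟨hI1, hJ1, hIJ1, hII, hTI, hTJ, hT3⟩ := tet_relations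
  -- A lift with T³ = z is replaced by zT, since z³ = z.
  obtain ⟨T, hT, hT3'⟩ : ∃ T, π T = tetT ∧ T ^ 3 = 1 := by
    obtain ⟨T, hT⟩ := hπ tetT
    have h : π (T ^ 3) = 1 := by rw [map_pow, hT, hT3]
    rcases (hker _).mp h with h | h
    · exact ⟨T, hT, h⟩
    · refine ⟨z * T, by rw [map_mul, hπz, one_mul, hT], ?_⟩
      rw [(show Commute z T from hcent T).mul_pow, h, pow_succ, pow_two, hzz, one_mul, hzz]
  have hconj : ∀ x, π x = tetI → π (T * x * T⁻¹) = tetJ := by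
    intro x hx
    rw [map_mul, map_mul, hT, hx, hTI, map_inv, hT, mul_inv_cancel_right]
  have hconj' : ∀ x, π x = tetJ → π (T * x * T⁻¹) = tetI * tetJ := by
    intro x hx
    rw [map_mul, map_mul, hT, hx, hTJ, map_inv, hT, mul_inv_cancel_right]
  -- The two sides agree up to z. Replacing I by zI multiplies the left side by z and the right side
  -- by z² = 1, so one of the two lifts satisfies the relation exactly.
  obtain ⟨I, hI, hIK⟩ : ∃ I, π I = tetI ∧
      T * (T * I * T⁻¹) * T⁻¹ = I * (T * I * T⁻¹) := by
    obtain ⟨I, hI⟩ := hπ tetI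
    have h : π (T * (T * I * T⁻¹) * T⁻¹) = π (I * (T * I * T⁻¹)) := by
      rw [hconj' _ (hconj I hI), map_mul, hI, hconj I hI]
    rcases hker2 _ _ h with h | h
    · exact ⟨I, hI, h⟩
    · refine ⟨z * I, by rw [map_mul, hπz, one_mul, hI], ?_⟩
      have h1 : T * (z * I) * T⁻¹ = z * (T * I * T⁻¹) := by
        simp only [← mul_assoc]; rw [hcent T]
      have h2 : T * (z * (T * I * T⁻¹)) * T⁻¹ = z * (T * (T * I * T⁻¹) * T⁻¹) := by
        rw [← mul_assoc T z, ← hcent T]; simp only [mul_assoc]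
      rw [h1, h2, h, mul_assoc z I, ← mul_assoc I z, ← hcent I]
      simp only [mul_assoc]
  set J := T * I * T⁻¹ with hJdef
  have hJ : π J = tetJ := hconj I hI
  have hTI' : T * I = J * T := by rw [hJdef, inv_mul_cancel_right]
  have hTJ' : T * J = I * J * T := by rw [← hIK, inv_mul_cancel_right]
  obtain ⟨n, hn, hIn⟩ : ∃ n < 2, I * I = z ^ n := by
    have h : π (I * I) = 1 := by rw [map_mul, hI, hII]
    rcases (hker _).mp h with h | h
    · exact ⟨0, by norm_num, by rw [h, pow_zero]⟩
    · exact ⟨1, by norm_num, by rw [h, pow_one]⟩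
  have hcn : ∀ x, z ^ n * x = x * z ^ n := fun x =>
    (show Commute z x from hcent x).pow_left n
  have hzn : z ^ n * z ^ n = 1 := by
    rw [← (show Commute z z from rfl).mul_pow, hzz, one_pow]
  -- J and IJ are conjugates of I under powers of T, so all three have the same square z^n.
  have hconjsq : ∀ x, x * x = z ^ n → (T * x * T⁻¹) * (T * x * T⁻¹) = z ^ n := by
    intro x hx
    have : (T * x * T⁻¹) * (T * x * T⁻¹) = T * (x * x) * T⁻¹ := by group
    rw [this, hx, ← hcn, mul_inv_cancel_right]
  have hJn : J * J = z ^ n := hconjsq I hIn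
  have hKn : I * J * (I * J) = z ^ n := by rw [← hIK]; exact hconjsq J hJn
  have hJI : J * I = z ^ n * (I * J) := by
    have h1 : I * (J * I) * J = z ^ n := by rw [← hKn]; simp only [mul_assoc]
    have h2 : I * (z ^ n * (I * J)) * J = z ^ n := by
      rw [← mul_assoc I, ← hcn I]
      calc z ^ n * I * (I * J) * J = z ^ n * (I * I) * (J * J) := by simp only [mul_assoc]
        _ = z ^ n := by rw [hIn, hJn, hzn, one_mul]
    exact mul_left_cancel (mul_right_cancel (h1.trans h2.symm))
  have hrel : TetrahedralRelations n I J T z :=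
    ⟨hzz, hcent, hIn, hJn, hJI, hTI', hTJ', hT3'⟩
  have hnot : ∀ x, π x ≠ 1 → x ∉ N := fun x hx h => hx ((hker x).mpr ((hN x).mp h))
  refine ⟨n, I, J, T, hn, hrel, fun x => ?_, hnot _ (by rwa [hI]), hnot _ (by rwa [hJ]),
    hnot _ (by rwa [map_mul, hI, hJ]), ?_⟩
  · obtain ⟨a, b, d, h⟩ := tet_surjective (π x)
    have : π x = π (I ^ (a : ℕ) * J ^ (b : ℕ) * T ^ (d : ℕ)) := by
      rw [h, map_mul, map_mul, map_pow, map_pow, map_pow, hI, hJ, hT]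
    rcases hker2 _ _ this with h | h
    · exact ⟨0, a, b, d, by rw [h, pow_zero, one_mul]⟩
    · exact ⟨1, a, b, d, by rw [h, pow_one]; simp only [mul_assoc]⟩
  · have hcardN : Nat.card N = 2 := by
      have : (N : Set G) = {1, z} := by ext x; simp [hN]
      rw [← SetLike.coe_sort_coe, this, Nat.card_coe_set_eq, Set.ncard_pair hz.symm]
    rw [Subgroup.card_eq_card_quotient_mul_card_subgroup N, hcardN, Nat.card_congr e.toEquiv,
      nat_card_alternatingGroup]
    simp [Nat.factorial]

end Extension

/-! ### A coordinate in which the reduced group is the standard tetrahedral group. -/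

/-- The finite roots of `F` are permuted by the transformations `X ↦ -X`, `X ↦ 1 / X` and
`X ↦ i (X + 1) / (X - 1)`, which generate the tetrahedral group. -/
structure TetrahedralRoots {k : Type*} [Field k] (i : k) (F : k[X]) : Prop where
  neg : ∀ p, F.eval p = 0 → F.eval (-p) = 0
  inv : ∀ p, p ≠ 0 → F.eval p = 0 → F.eval p⁻¹ = 0
  rot : ∀ p, p ≠ 1 → F.eval p = 0 → F.eval (i * (p + 1) / (p - 1)) = 0

namespace HyperellipticCurve

section NormalCoordinates

variable {k K : Type*} [Field k] [Field K] [Algebra k K] {g : ℕ}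

lemma quadratic_eq_zero (C : HyperellipticCurve k K g) {a b c : k}
    (h : algebraMap k K a * C.x ^ 2 + algebraMap k K b * C.x + algebraMap k K c = 0) :
    a = 0 ∧ b = 0 ∧ c = 0 := by
  have h0 : Polynomial.C a * X ^ 2 + Polynomial.C b * X + Polynomial.C c = 0 := by
    by_contra hne
    exact C.aeval_ne_zero hne (by simpa using h)
  have h1 := congrArg (fun f => coeff f 2) h0
  have h2 := congrArg (fun f => coeff f 1) h0
  have h3 := congrArg (fun f => coeff f 0) h0
  simp [coeff_C, coeff_X] at h1 h2 h3
  exact ⟨h1, h2, h3⟩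

lemma x_sub_ne_zero (C : HyperellipticCurve k K g) (a : k) : C.x - algebraMap k K a ≠ 0 := by
  have := C.aeval_ne_zero (X_sub_C_ne_zero a)
  simpa using this

lemma x_ne_zero (C : HyperellipticCurve k K g) : C.x ≠ 0 := by
  simpa using C.x_sub_ne_zero 0

lemma rationalSubfield_le {C C' : HyperellipticCurve k K g} (h : C'.x ∈ C.rationalSubfield) :
    C'.rationalSubfield ≤ C.rationalSubfield := by
  rw [rationalSubfield, IntermediateField.adjoin_simple_le_iff]
  exact h

lemma x_mem (C : HyperellipticCurve k K g) : C.x ∈ C.rationalSubfield :=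
  IntermediateField.mem_adjoin_simple_self k C.x

lemma affine_rationalSubfield (C : HyperellipticCurve k K g) (a b : k) (ha : a ≠ 0) :
    (C.affine a b ha).rationalSubfield = C.rationalSubfield := by
  refine le_antisymm (rationalSubfield_le ?_) (rationalSubfield_le ?_)
  · exact mul_mem (C.rationalSubfield.algebraMap_mem _)
      (sub_mem C.x_mem (C.rationalSubfield.algebraMap_mem _))
  · have h := (C.affine a b ha).x_mem
    set S := (C.affine a b ha).rationalSubfield
    have h1 := add_mem (mul_mem (S.algebraMap_mem a) h) (S.algebraMap_mem b)
    rwa [affine_x, ← mul_assoc, ← map_mul, mul_inv_cancel₀ ha, map_one, one_mul,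
      sub_add_cancel] at h1

lemma inversion_rationalSubfield (C : HyperellipticCurve k K g) :
    C.inversion.rationalSubfield = C.rationalSubfield := by
  refine le_antisymm (rationalSubfield_le ?_) (rationalSubfield_le ?_)
  · exact inv_mem C.x_mem
  · simpa [inversion_x] using inv_mem C.inversion.x_mem

lemma exists_moebius' [CharZero k] (C : HyperellipticCurve k K g) (σ : K ≃ₐ[k] K) :
    ∃ a b c d : k, a * d - b * c ≠ 0 ∧
      σ C.x * (algebraMap k K c * C.x + algebraMap k K d)
        = algebraMap k K a * C.x + algebraMap k K b := by
  obtain ⟨a, b, c, d, hdet, h⟩ := C.exists_moebius σ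
  exact ⟨a, b, c, d, hdet, by simpa using h⟩

lemma exists_apply_eq_neg_of_add [CharZero k] (C : HyperellipticCurve k K g) {σ : K ≃ₐ[k] K}
    {b : k} (h : σ C.x = -C.x + algebraMap k K b) : ∃ C' : HyperellipticCurve k K g,
      C'.rationalSubfield = C.rationalSubfield ∧ σ C'.x = -C'.x := by
  refine ⟨C.affine 1 (b / 2) one_ne_zero, C.affine_rationalSubfield _ _ _, ?_⟩
  rw [affine_x, map_mul, map_sub, AlgEquiv.commutes, AlgEquiv.commutes, h]
  have : algebraMap k K b = algebraMap k K (b / 2) + algebraMap k K (b / 2) := by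
    rw [← map_add, add_halves]
  rw [this, inv_one, map_one]
  ring

/-- An involution of `k(x)` becomes `x ↦ -x` in a suitable coordinate. -/
lemma exists_apply_eq_neg [CharZero k] [IsAlgClosed k] (C : HyperellipticCurve k K g)
    {σ : K ≃ₐ[k] K} (hσ : σ (σ C.x) = C.x) (hne : σ C.x ≠ C.x) :
    ∃ C' : HyperellipticCurve k K g,
      C'.rationalSubfield = C.rationalSubfield ∧ σ C'.x = -C'.x := by
  obtain ⟨a, b, c, d, hdet, h⟩ := C.exists_moebius' σ
  set u := σ C.x with hu
  have h' : C.x * (algebraMap k K c * u + algebraMap k K d)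
      = algebraMap k K a * u + algebraMap k K b := by
    have := congrArg σ h
    simpa only [map_mul, map_add, AlgEquiv.commutes, hσ] using this
  -- A matrix whose square is scalar is itself scalar or has trace zero. In terms of x, eliminating
  -- σ x from the two relations gives (a + d)(cx² + (d - a)x - b) = 0.
  have hquad : algebraMap k K (c * (a + d)) * C.x ^ 2 + algebraMap k K ((d - a) * (a + d)) * C.x
      + algebraMap k K (-(b * (a + d))) = 0 := by
    simp only [map_mul, map_add, map_neg, map_sub]
    linear_combination (algebraMap k K c * C.x + algebraMap k K d) * h' -
      (algebraMap k K c * C.x - algebraMap k K a) * h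
  obtain ⟨h1, h2, h3⟩ := C.quadratic_eq_zero hquad
  have htr : a + d = 0 := by
    by_contra htr
    have hc : c = 0 := by simpa [htr] using h1
    have hb : b = 0 := by simpa [htr] using h3
    have hda : d - a = 0 := by simpa [htr] using h2
    obtain rfl : d = a := sub_eq_zero.mp hda
    subst hc hb
    have hd : d ≠ 0 := by rintro rfl; simp at hdet
    apply hne
    rw [map_zero, zero_mul, zero_add, add_zero, mul_comm] at h
    exact mul_left_cancel₀ ((map_ne_zero (algebraMap k K)).mpr hd) h
  obtain rfl : d = -a := by linear_combination htr
  by_cases hc : c = 0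
  · subst hc
    have ha : a ≠ 0 := by rintro rfl; simp at hdet
    refine C.exists_apply_eq_neg_of_add (b := -b / a) ?_
    rw [← hu]
    have ha' := (map_ne_zero (algebraMap k K)).mpr ha
    simp only [map_zero, map_neg, map_div₀] at h ⊢
    field_simp
    linear_combination -h
  -- The fixed points are (a ± s)/c. Sending q = (a + s)/c to ∞ by 1/(x - q) makes the involution
  -- affine, and -c/s is twice the new coordinate of the other fixed point.
  · obtain ⟨s, hs⟩ := IsAlgClosed.exists_pow_nat_eq (a ^ 2 + b * c) (n := 2) (by norm_num)
    have hs0 : s ≠ 0 := by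
      rintro rfl
      apply hdet
      linear_combination hs
    obtain ⟨q, hq⟩ : ∃ q, c * q = a + s := ⟨(a + s) / c, mul_div_cancel₀ _ hc⟩
    have hbq : b + c * q ^ 2 = 2 * q * s := by
      refine mul_left_cancel₀ hc ?_
      linear_combination (c * q + a + s - 2 * s) * hq - hs
    have hq' : algebraMap k K c * algebraMap k K q = algebraMap k K a + algebraMap k K s := by
      rw [← map_mul, hq, map_add]
    have hbq' : algebraMap k K b + algebraMap k K c * algebraMap k K q ^ 2
        = 2 * algebraMap k K q * algebraMap k K s := by
      rw [← map_pow, ← map_mul, ← map_add, hbq, map_mul, map_mul, map_ofNat]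
    obtain ⟨C', h1, h2⟩ := (C.affine 1 q one_ne_zero).inversion.exists_apply_eq_neg_of_add
      (σ := σ) (b := -c / s) (by
        rw [inversion_x, affine_x, inv_one, map_one, one_mul, map_inv₀, map_sub,
          AlgEquiv.commutes, ← hu, map_div₀, map_neg]
        have hx1 := C.x_sub_ne_zero q
        have hx2 : u - algebraMap k K q ≠ 0 := by
          intro h0
          apply hx1
          have := congrArg σ h0
          simpa [hσ] using this
        have hs' := (map_ne_zero (algebraMap k K)).mpr hs0
        rw [map_neg] at h
        field_simp
        linear_combination h - (u + C.x) * hq' + hbq')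
    exact ⟨C', h1.trans ((inversion_rationalSubfield _).trans (affine_rationalSubfield _ _ _ _)), h2⟩

lemma apply_mem' [CharZero k] {C C' : HyperellipticCurve k K g}
    (hC : C'.rationalSubfield = C.rationalSubfield) (σ : K ≃ₐ[k] K) :
    σ C'.x ∈ C.rationalSubfield :=
  hC ▸ C'.apply_x_mem σ

/-- A Klein four-group of automorphisms of `k(x)` is generated by `x ↦ -x` and `x ↦ 1 / x` in a
suitable coordinate. -/
lemma exists_klein_coordinate [CharZero k] [IsAlgClosed k] (C : HyperellipticCurve k K g)
    {σ τ : K ≃ₐ[k] K} (hσ : σ C.x = -C.x) (hτ : τ (τ C.x) = C.x) (hστ : σ (τ C.x) = -τ C.x)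
    (h1 : τ C.x ≠ C.x) (h2 : τ C.x ≠ -C.x) :
    ∃ C' : HyperellipticCurve k K g, C'.rationalSubfield = C.rationalSubfield ∧
      σ C'.x = -C'.x ∧ τ C'.x * C'.x = 1 := by
  have : CharZero K := charZero_of_injective_algebraMap (algebraMap k K).injective
  obtain ⟨a, b, c, d, hdet, h⟩ := C.exists_moebius' τ
  set u := τ C.x with hu
  have h' : -u * (algebraMap k K c * -C.x + algebraMap k K d)
      = algebraMap k K a * -C.x + algebraMap k K b := by
    have := congrArg σ h
    simpa only [map_mul, map_add, AlgEquiv.commutes, hσ, hστ] using this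
  -- Commutation with x ↦ -x splits the Möbius relation into its even and odd parts. If c = 0 then u
  -- = ±x, which is excluded, so u·x is constant and rescaling by a square root makes it 1.
  have hc1 : algebraMap k K c * (u * C.x) = algebraMap k K b := by
    refine mul_left_cancel₀ (two_ne_zero (α := K)) ?_
    linear_combination h + h'
  have hc2 : algebraMap k K d * u = algebraMap k K a * C.x := by
    refine mul_left_cancel₀ (two_ne_zero (α := K)) ?_
    linear_combination h - h'
  have hc : c ≠ 0 := by
    rintro rfl
    have hd : d ≠ 0 := by rintro rfl; simp at hdet
    have hd' := (map_ne_zero (algebraMap k K)).mpr hd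
    have h3 := congrArg τ hc2
    simp only [map_mul, AlgEquiv.commutes, hτ, ← hu] at h3
    have h4 : algebraMap k K (d ^ 2) * C.x = algebraMap k K (a ^ 2) * C.x := by
      rw [map_pow, map_pow]
      linear_combination algebraMap k K d * h3 + algebraMap k K a * hc2
    have h5 := (algebraMap k K).injective (mul_right_cancel₀ C.x_ne_zero h4)
    rcases sq_eq_sq_iff_eq_or_eq_neg.mp h5 with rfl | rfl
    · exact h1 (mul_left_cancel₀ hd' hc2)
    · apply h2
      refine mul_left_cancel₀ hd' ?_
      rw [map_neg] at hc2 ⊢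
      linear_combination hc2
  have hc' := (map_ne_zero (algebraMap k K)).mpr hc
  have hux : u * C.x = algebraMap k K (b / c) := by
    rw [map_div₀, eq_div_iff hc', mul_comm, hc1]
  obtain ⟨s, hs⟩ := IsAlgClosed.exists_pow_nat_eq (b / c) (n := 2) (by norm_num)
  have hs0 : s ≠ 0 := by
    rintro rfl
    rw [← hs, zero_pow two_ne_zero, map_zero, mul_eq_zero, hu, map_eq_zero] at hux
    simp [C.x_ne_zero] at hux
  refine ⟨C.affine s 0 hs0, C.affine_rationalSubfield _ _ _, ?_, ?_⟩
  · rw [affine_x, map_mul, map_sub, AlgEquiv.commutes, AlgEquiv.commutes, hσ, map_zero]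
    ring
  · rw [affine_x, map_mul, map_sub, AlgEquiv.commutes, AlgEquiv.commutes, ← hu, map_zero, map_inv₀]
    have hs' := (map_ne_zero (algebraMap k K)).mpr hs0
    field_simp
    rw [sub_zero, sub_zero, hux, ← hs, map_pow]

/-- An automorphism of `k(x)` that permutes the involutions `x ↦ -x`, `x ↦ 1 / x`, `x ↦ -1 / x`
cyclically. -/
lemma exists_rotation [CharZero k] (C : HyperellipticCurve k K g)
    {σ τ ρ : K ≃ₐ[k] K} (hσ : σ C.x = -C.x) (hτ : τ C.x * C.x = 1) (hτρ : τ (ρ C.x) = -ρ C.x)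
    (hσρ : σ (ρ C.x) * ρ C.x = -1) : ∃ e : k, e ^ 2 = -1 ∧
      (ρ C.x * (C.x - 1) = algebraMap k K e * (C.x + 1) ∨
        ρ C.x * (C.x + 1) = algebraMap k K e * (C.x - 1)) := by
  have : CharZero K := charZero_of_injective_algebraMap (algebraMap k K).injective
  obtain ⟨a, b, c, d, hdet, h⟩ := C.exists_moebius' ρ
  set u := ρ C.x with hu
  have hu0 : u ≠ 0 := by rw [hu, Ne, map_eq_zero]; exact C.x_ne_zero
  have h2 : -u * (algebraMap k K c + algebraMap k K d * C.x)
      = algebraMap k K a + algebraMap k K b * C.x := by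
    have := congrArg τ h
    simp only [map_mul, map_add, AlgEquiv.commutes, hτρ] at this
    linear_combination C.x * this + (u * algebraMap k K c + algebraMap k K a) * hτ
  have h3 : -(algebraMap k K c * -C.x + algebraMap k K d)
      = u * (algebraMap k K a * -C.x + algebraMap k K b) := by
    have := congrArg σ h
    simp only [map_mul, map_add, AlgEquiv.commutes, hσ] at this
    linear_combination u * this -
      (algebraMap k K c * -C.x + algebraMap k K d) * hσρ
  -- Eliminating u among the relation and its images under τ and σ gives two quadratics in x. All
  -- their coefficients vanish, whence b = ±a, d = ∓c and (a/c)² = -1.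
  have q1 : algebraMap k K (a * d + b * c) * C.x ^ 2 + algebraMap k K (2 * (a * c + b * d)) * C.x
      + algebraMap k K (a * d + b * c) = 0 := by
    simp only [map_mul, map_add, map_ofNat]
    linear_combination -(algebraMap k K c + algebraMap k K d * C.x) * h
      - (algebraMap k K c * C.x + algebraMap k K d) * h2
  have q2 : algebraMap k K (a ^ 2 + c ^ 2) * C.x ^ 2 + algebraMap k K 0 * C.x
      + algebraMap k K (-(b ^ 2 + d ^ 2)) = 0 := by
    simp only [map_zero, map_add, map_pow, map_neg]
    linear_combination (algebraMap k K a * -C.x + algebraMap k K b) * h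
      + (algebraMap k K c * C.x + algebraMap k K d) * h3
  obtain ⟨e1, e2, -⟩ := C.quadratic_eq_zero q1
  obtain ⟨e3, -, e4⟩ := C.quadratic_eq_zero q2
  have e2' : a * c + b * d = 0 := by simpa using e2
  have hc : c ≠ 0 := by
    rintro rfl
    have ha : a = 0 := by simpa using e3
    subst ha
    simp at hdet
  have ha : a ≠ 0 := by
    rintro rfl
    exact hc (by simpa using e3)
  have hab : b ^ 2 = a ^ 2 := by
    refine mul_left_cancel₀ hc ?_
    linear_combination b * e1 - a * e2'
  have hc' := (map_ne_zero (algebraMap k K)).mpr hc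
  refine ⟨a / c, ?_, ?_⟩
  · rw [div_pow, div_eq_iff (pow_ne_zero 2 hc)]
    linear_combination e3
  rcases sq_eq_sq_iff_eq_or_eq_neg.mp hab with rfl | rfl
  · left
    have hd : d = -c := mul_left_cancel₀ ha (by linear_combination e1)
    subst hd
    rw [map_div₀, div_mul_eq_mul_div, eq_div_iff hc']
    rw [map_neg] at h
    linear_combination h
  · right
    have hd : d = c := mul_left_cancel₀ ha (by linear_combination e1)
    subst hd
    rw [map_div₀, div_mul_eq_mul_div, eq_div_iff hc']
    rw [map_neg] at h
    linear_combination h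

/-- A curve whose reduced automorphism group is tetrahedral has a coordinate in which that group
is the standard tetrahedral group. -/
theorem exists_tetrahedral_coordinate [CharZero k] [IsAlgClosed k]
    (C : HyperellipticCurve k K g) {n : ℕ} {I J T z : K ≃ₐ[k] K}
    (h : TetrahedralRelations n I J T z) (hz : z ∈ C.hyperellipticSubgroup)
    (hI : I ∉ C.hyperellipticSubgroup) (hJ : J ∉ C.hyperellipticSubgroup)
    (hIJ : I * J ∉ C.hyperellipticSubgroup) {i : k} (hi : i ^ 2 = -1) :
    ∃ C' : HyperellipticCurve k K g, C'.rationalSubfield = C.rationalSubfield ∧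
      I C'.x = -C'.x ∧ TetrahedralRoots i C'.F ∧
      (C'.F.eval 0 = 0 ↔ C'.F.natDegree = 2 * g + 1) := by
  have hsub : ∀ {C' : HyperellipticCurve k K g}, C'.rationalSubfield = C.rationalSubfield →
      ∀ σ, σ C'.x = C'.x → σ ∈ C.hyperellipticSubgroup := by
    intro C' hC' σ hσ
    have := (C'.mem_hyperellipticSubgroup_iff σ).mpr hσ
    rwa [hyperellipticSubgroup, hC'] at this
  -- On k(x) the factors z^n disappear, so I and J act there as commuting involutions.
  have hfix : ∀ y ∈ C.rationalSubfield, (z ^ n) y = y := fun y hy =>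
    C.apply_eq_of_mem (pow_mem hz n) hy
  obtain ⟨C₁, hC₁, hI₁⟩ := C.exists_apply_eq_neg (σ := I)
    (by rw [← AlgEquiv.mul_apply, h.I_mul_self, hfix _ C.x_mem])
    (fun h0 => hI ((C.mem_hyperellipticSubgroup_iff I).mpr h0))
  have hmem₁ : C₁.x ∈ C.rationalSubfield := hC₁ ▸ C₁.x_mem
  obtain ⟨C₂, hC₂, hI₂, hJ₂⟩ := C₁.exists_klein_coordinate (σ := I) (τ := J) hI₁
    (by rw [← AlgEquiv.mul_apply, h.J_mul_self, hfix _ hmem₁])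
    (by
      have h1 := DFunLike.congr_fun h.J_mul_I C₁.x
      rw [AlgEquiv.mul_apply, AlgEquiv.mul_apply, hfix _ (apply_mem' hC₁ _), hI₁, map_neg,
        AlgEquiv.mul_apply] at h1
      exact h1.symm)
    (fun h0 => hJ (hsub hC₁ J h0))
    (fun h0 => hIJ (hsub hC₁ (I * J) (by rw [AlgEquiv.mul_apply, h0, map_neg, hI₁, neg_neg])))
  have hC₂' := hC₂.trans hC₁
  have hJT : J (T C₂.x) = -T C₂.x := by
    rw [← AlgEquiv.mul_apply, ← h.T_mul_I, AlgEquiv.mul_apply, hI₂, map_neg]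
  have hJx : J C₂.x = C₂.x⁻¹ := eq_inv_of_mul_eq_one_left hJ₂
  have hIT : I (T C₂.x) * T C₂.x = -1 := by
    have h1 := DFunLike.congr_fun h.T_mul_J C₂.x
    rw [AlgEquiv.mul_apply, AlgEquiv.mul_apply, AlgEquiv.mul_apply, hJT, hJx, map_inv₀,
      map_neg] at h1
    rw [← neg_eq_iff_eq_neg, ← neg_mul, ← h1, inv_mul_cancel₀]
    rw [Ne, map_eq_zero]; exact C₂.x_ne_zero
  obtain ⟨e, he, hT⟩ := C₂.exists_rotation hI₂ hJ₂ hJT hIT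
  have hneg : ∀ p, C₂.F.eval p = 0 → C₂.F.eval (-p) = 0 := fun p hp =>
    C₂.eval_moebius_eq_zero I (P := -X) (Q := 1) (by simpa using hI₂) hp (by simp) (by simp)
  -- The second form of the rotation, evaluated at -p, is the first form at p. The ambiguity e = ±i
  -- below is likewise absorbed by the symmetry p ↦ -p.
  have hrot : ∀ p, p ≠ 1 → C₂.F.eval p = 0 → C₂.F.eval (e * (p + 1) / (p - 1)) = 0 := by
    intro p hp1 hp
    have hp1' := sub_ne_zero.mpr hp1
    rcases hT with hT | hT
    · refine C₂.eval_moebius_eq_zero T (P := Polynomial.C e * (X + 1)) (Q := X - 1)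
        (by simpa using hT) hp (by simpa using hp1') ?_
      simp [div_mul_cancel₀ _ hp1']
    · refine C₂.eval_moebius_eq_zero T (P := Polynomial.C e * (X - 1)) (Q := X + 1)
        (by simpa using hT) (hneg p hp) ?_ ?_
      · simp only [eval_add, eval_X, eval_one]
        intro h0
        exact hp1' (by linear_combination -h0)
      · simp only [eval_add, eval_sub, eval_mul, eval_C, eval_X, eval_one]
        field_simp
        ring
  refine ⟨C₂, hC₂', hI₂, ⟨hneg, fun p hp0 hp => ?_, fun p hp1 hp => ?_⟩,
    C₂.eval_zero_eq_zero_iff J hJ₂⟩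
  · exact C₂.eval_moebius_eq_zero J (P := 1) (Q := X) (by simpa using hJ₂) hp (by simpa using hp0)
      (by simp [hp0])
  · have : (e - i) * (e + i) = 0 := by linear_combination he - hi
    rcases mul_eq_zero.mp this with h0 | h0
    · rw [← sub_eq_zero.mp h0]; exact hrot p hp1 hp
    · have := hneg _ (hrot p hp1 hp)
      rwa [eq_neg_of_add_eq_zero_left h0, neg_mul, neg_div, neg_neg] at this

end NormalCoordinates

end HyperellipticCurve

/-! ### Orbit polynomials, and the factorization of a tetrahedrally invariant polynomial. -/

section Factorization

variable {k : Type*} [Field k]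

lemma squarefree_of_eval_derivative_ne_zero [IsAlgClosed k] {P : k[X]}
    (h : ∀ p, P.eval p = 0 → P.derivative.eval p ≠ 0) : Squarefree P := by
  refine Separable.squarefree ?_
  rw [Separable, isCoprime_iff_aeval_ne_zero_of_isAlgClosed k k]
  intro p
  by_cases hp : P.eval p = 0
  · exact Or.inr (by simpa using h p hp)
  · exact Or.inl (by simpa using hp)

lemma isCoprime_of_eval_ne_zero [IsAlgClosed k] {P Q : k[X]}
    (h : ∀ p, P.eval p = 0 → Q.eval p ≠ 0) : IsCoprime P Q := by
  rw [isCoprime_iff_aeval_ne_zero_of_isAlgClosed k k]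
  intro p
  by_cases hp : P.eval p = 0
  · exact Or.inr (by simpa using h p hp)
  · exact Or.inl (by simpa using hp)

lemma dvd_of_squarefree_of_eval [IsAlgClosed k] [CharZero k] {P F : k[X]} (hP : Squarefree P)
    (h : ∀ p, P.eval p = 0 → F.eval p = 0) : P ∣ F := by
  by_cases hF : F = 0
  · rw [hF]; exact dvd_zero P
  rw [IsAlgClosed.dvd_iff_roots_le_roots hP.ne_zero hF,
    Multiset.le_iff_subset (nodup_roots (PerfectField.separable_iff_squarefree.mpr hP))]
  intro p hp
  rw [mem_roots hF]
  exact h p (isRoot_of_mem_roots hp)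

/-- The G_λ form the pencil N - λR², so their roots are the fibres of the A₄-invariant function
N/R². -/
lemma eval_orbitPoly (a p : k) : (orbitPoly a).eval p
    = (p ^ 12 - 33 * p ^ 8 - 33 * p ^ 4 + 1) - a * ((polyR k).eval p) ^ 2 := by
  simp [orbitPoly, polyR]
  ring

lemma eval_polyR (p : k) : (polyR k).eval p = p * (p ^ 4 - 1) := by
  simp [polyR]

lemma eval_polyT (i r p : k) : (polyT i r).eval p = p ^ 4 + 2 * i * r * p ^ 2 + 1 := by
  simp [polyT]

lemma polyT_mul_polyT_neg {i r : k} (hi : i ^ 2 = -1) (hr : r ^ 2 = 3) :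
    polyT i r * polyT (-i) r = polyST k := by
  have h : (Polynomial.C i * Polynomial.C r) ^ 2 = (-3 : k[X]) := by
    rw [← map_mul, ← map_pow, mul_pow, hi, hr, neg_one_mul, map_neg, map_ofNat]
  simp only [polyT, polyST, map_mul, map_neg, map_ofNat]
  linear_combination (-4 * X ^ 4) * h

/-- T³ is the member of the pencil with λ = -6ir, and S³ the one with λ = 6ir. These are the two
values with λ² = -108. -/
lemma eval_polyT_pow_three {i r : k} (hi : i ^ 2 = -1) (hr : r ^ 2 = 3) (p : k) :
    (polyT i r).eval p ^ 3
      = (p ^ 12 - 33 * p ^ 8 - 33 * p ^ 4 + 1) + 6 * i * r * ((polyR k).eval p) ^ 2 := by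
  have h : (i * r) ^ 2 = -3 := by rw [mul_pow, hi, hr]; ring
  rw [eval_polyT, eval_polyR]
  linear_combination (12 * p ^ 8 + 12 * p ^ 4 + 8 * i * r * p ^ 6) * h

/-- N equals 1 at 0 and -64 where p⁴ = 1. Since N and R² have no common root, distinct members of
the pencil are coprime. -/
lemma eval_numerator_ne_zero [CharZero k] {p : k} (h : (polyR k).eval p = 0) :
    p ^ 12 - 33 * p ^ 8 - 33 * p ^ 4 + 1 ≠ 0 := by
  rw [eval_polyR] at h
  rcases mul_eq_zero.mp h with rfl | h
  · simp
  · have h4 : p ^ 4 = 1 := sub_eq_zero.mp h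
    rw [show p ^ 12 - 33 * p ^ 8 - 33 * p ^ 4 + 1 = (p ^ 4) ^ 3 - 33 * (p ^ 4) ^ 2 - 33 * p ^ 4 + 1
      by ring, h4]
    norm_num

lemma eval_orbitPoly_ne_zero_of_polyR [CharZero k] {a p : k} (h : (polyR k).eval p = 0) :
    (orbitPoly a).eval p ≠ 0 := by
  rw [eval_orbitPoly, h]
  simpa using eval_numerator_ne_zero h

lemma eval_polyT_ne_zero_of_polyR [CharZero k] {i r p : k} (hi : i ^ 2 = -1) (hr : r ^ 2 = 3)
    (h : (polyR k).eval p = 0) : (polyT i r).eval p ≠ 0 := by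
  intro h0
  have := eval_polyT_pow_three hi hr p
  rw [h0, h] at this
  exact eval_numerator_ne_zero h (by linear_combination -this)

lemma sq_add_eq_zero {i r : k} (hi : i ^ 2 = -1) (hr : r ^ 2 = 3) :
    (6 * i * r) ^ 2 + 108 = 0 := by
  rw [mul_pow, mul_pow, hi, hr]; ring

lemma eval_polyT_ne_zero_of_orbitPoly [CharZero k] {i r a p : k} (hi : i ^ 2 = -1)
    (hr : r ^ 2 = 3) (ha : a ^ 2 + 108 ≠ 0) (h : (orbitPoly a).eval p = 0) :
    (polyT i r).eval p ≠ 0 := by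
  intro h0
  have hR : (polyR k).eval p ≠ 0 := fun hR => eval_orbitPoly_ne_zero_of_polyR hR h
  have h1 := eval_polyT_pow_three hi hr p
  rw [h0] at h1
  rw [eval_orbitPoly] at h
  have h2 : (6 * i * r + a) * (polyR k).eval p ^ 2 = 0 := by linear_combination -h1 - h
  have h3 := (mul_eq_zero.mp h2).resolve_right (pow_ne_zero 2 hR)
  apply ha
  rw [← sq_add_eq_zero hi hr]
  linear_combination (a - 6 * i * r) * h3

lemma ne_zero_of_sq {i : k} (hi : i ^ 2 = -1) : i ≠ 0 := by
  rintro rfl; simp at hi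

lemma ne_zero_of_sq_three [CharZero k] {r : k} (hr : r ^ 2 = 3) : r ≠ 0 := by
  rintro rfl; norm_num at hr

lemma eval_polyT_neg_ne_zero [CharZero k] {i r p : k} (hi : i ^ 2 = -1) (hr : r ^ 2 = 3)
    (h : (polyT i r).eval p = 0) : (polyT (-i) r).eval p ≠ 0 := by
  intro h0
  have hR : (polyR k).eval p ≠ 0 := fun hR => eval_polyT_ne_zero_of_polyR hi hr hR h
  have h1 := eval_polyT_pow_three hi hr p
  have h2 := eval_polyT_pow_three (i := -i) (by rw [neg_sq, hi]) hr p
  rw [h] at h1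
  rw [h0] at h2
  have h3 : 12 * i * r * (polyR k).eval p ^ 2 = 0 := by linear_combination h2 - h1
  simp [ne_zero_of_sq hi, ne_zero_of_sq_three hr, hR] at h3

lemma eval_orbitPoly_ne_zero_of_ne [CharZero k] {a b p : k} (hab : a ≠ b)
    (h : (orbitPoly a).eval p = 0) : (orbitPoly b).eval p ≠ 0 := by
  intro h0
  have hR : (polyR k).eval p ≠ 0 := fun hR => eval_orbitPoly_ne_zero_of_polyR hR h
  rw [eval_orbitPoly] at h h0
  have h3 : (a - b) * (polyR k).eval p ^ 2 = 0 := by linear_combination h0 - h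
  exact hR (pow_eq_zero_iff two_ne_zero |>.mp
    ((mul_eq_zero.mp h3).resolve_left (sub_ne_zero.mpr hab)))

lemma squarefree_polyR [IsAlgClosed k] [CharZero k] : Squarefree (polyR k) := by
  refine squarefree_of_eval_derivative_ne_zero fun p hp => ?_
  rw [eval_polyR] at hp
  simp only [polyR, derivative_mul, derivative_X, derivative_sub, derivative_X_pow,
    derivative_one, eval_add, eval_mul, eval_sub, eval_pow, eval_X, eval_one, eval_C, one_mul,
    sub_zero]
  intro h
  rcases mul_eq_zero.mp hp with rfl | hp
  · norm_num at h
  · have : (4 : k) = 0 := by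
      push_cast at h
      linear_combination h - 5 * hp
    norm_num at this

lemma squarefree_polyT [IsAlgClosed k] [CharZero k] {i r : k} (hi : i ^ 2 = -1)
    (hr : r ^ 2 = 3) : Squarefree (polyT i r) := by
  have his : (i * r) ^ 2 = -3 := by rw [mul_pow, hi, hr]; ring
  refine squarefree_of_eval_derivative_ne_zero fun p hp => ?_
  rw [eval_polyT] at hp
  simp only [polyT, derivative_add, derivative_C_mul, derivative_X_pow, derivative_one, eval_add,
    eval_mul, eval_pow, eval_X, eval_C, add_zero]
  intro h
  push_cast at h
  have h1 : p * (p ^ 2 + i * r) = 0 := by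
    refine mul_left_cancel₀ (show (4 : k) ≠ 0 by norm_num) ?_
    linear_combination h
  rcases mul_eq_zero.mp h1 with rfl | h1
  · norm_num at hp
  · have : (4 : k) = 0 := by linear_combination hp - (p ^ 2 + i * r) * h1 + his
    norm_num at this

lemma squarefree_orbitPoly [IsAlgClosed k] [CharZero k] {i r : k} (hi : i ^ 2 = -1)
    (hr : r ^ 2 = 3) {a : k} (ha : a ^ 2 + 108 ≠ 0) : Squarefree (orbitPoly a) := by
  refine squarefree_of_eval_derivative_ne_zero fun p hp => ?_
  have hR : (polyR k).eval p ≠ 0 := fun hR => eval_orbitPoly_ne_zero_of_polyR hR hp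
  have hT := eval_polyT_ne_zero_of_orbitPoly hi hr ha hp
  have hS := eval_polyT_ne_zero_of_orbitPoly (i := -i) (by rw [neg_sq, hi]) hr ha hp
  intro h
  have hST : ((polyST k).eval p) ^ 2 * (polyR k).eval p ≠ 0 := by
    rw [← polyT_mul_polyT_neg hi hr, eval_mul]
    exact mul_ne_zero (pow_ne_zero 2 (mul_ne_zero hT hS)) hR
  apply hST
  rw [eval_orbitPoly] at hp
  simp only [orbitPoly, derivative_add, derivative_sub, derivative_X_pow,
    derivative_one, derivative_mul, derivative_ofNat, eval_add, eval_sub, eval_mul, eval_pow,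
    eval_X, eval_C, eval_ofNat, zero_mul, zero_add, add_zero] at h
  simp only [Nat.add_one_sub_one] at h
  push_cast at h
  norm_num at h
  rw [eval_polyR] at hp ⊢
  simp only [polyST, eval_add, eval_mul, eval_pow, eval_X, eval_one, eval_ofNat]
  refine mul_left_cancel₀ (two_ne_zero (α := k)) ?_
  -- Eliminating λ between G and G' gives R²·G' - (R²)'·G = 2R·(ST)². So N/R² ramifies only over the
  -- special orbits.
  linear_combination (p ^ 10 - 2 * p ^ 6 + p ^ 2) * h - (10 * p ^ 9 - 12 * p ^ 5 + 2 * p) * hp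

namespace TetrahedralRoots

variable {i : k} {F : k[X]}

lemma of_sq_eq (hF : TetrahedralRoots i F) {p q : k} (hp : F.eval p = 0) (h : q ^ 2 = p ^ 2) :
    F.eval q = 0 := by
  rcases sq_eq_sq_iff_eq_or_eq_neg.mp h with rfl | rfl
  · exact hp
  · exact hF.neg _ hp

lemma of_sq_mul_sq (hF : TetrahedralRoots i F) {p q : k} (hp : F.eval p = 0)
    (h : q ^ 2 * p ^ 2 = 1) : F.eval q = 0 := by
  have hp0 : p ≠ 0 := by rintro rfl; simp at h
  refine hF.of_sq_eq (hF.inv p hp0 hp) ?_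
  rw [inv_pow]
  exact eq_inv_of_mul_eq_one_left h

/-- T is palindromic in p², so its roots are ±p and ±1/p, a single orbit of the Klein four-group. -/
lemma eval_eq_zero_of_polyT (hF : TetrahedralRoots i F) {j r p q : k} (hp : F.eval p = 0)
    (hTp : (polyT j r).eval p = 0) (hTq : (polyT j r).eval q = 0) : F.eval q = 0 := by
  rw [eval_polyT] at hTp hTq
  have : (q ^ 2 - p ^ 2) * (q ^ 2 * p ^ 2 - 1) = 0 := by
    linear_combination p ^ 2 * hTq - q ^ 2 * hTp
  rcases mul_eq_zero.mp this with h | h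
  · exact hF.of_sq_eq hp (sub_eq_zero.mp h)
  · exact hF.of_sq_mul_sq hp (sub_eq_zero.mp h)

lemma of_rot (hF : TetrahedralRoots i F) (hi : i ^ 2 = -1) {p q : k} (hp : F.eval p = 0)
    (hp1 : p ≠ 1) (h : q ^ 2 * (p - 1) ^ 2 + (p + 1) ^ 2 = 0) : F.eval q = 0 := by
  refine hF.of_sq_eq (hF.rot p hp1 hp) ?_
  rw [div_pow, eq_div_iff (pow_ne_zero 2 (sub_ne_zero.mpr hp1)), mul_pow, hi]
  linear_combination h

/-- The square of the rotation is p ↦ (p + i)/(p - i). The points 1 and i are excluded because the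
first or the second rotation sends them to ∞. -/
lemma of_rot_rot (hF : TetrahedralRoots i F) (hi : i ^ 2 = -1) (h2 : (2 : k) ≠ 0) {p q : k}
    (hp : F.eval p = 0) (hp1 : p ≠ 1) (hpi : p ≠ i)
    (h : q ^ 2 * (p - i) ^ 2 - (p + i) ^ 2 = 0) : F.eval q = 0 := by
  have hp1' := sub_ne_zero.mpr hp1
  have hi1 : i - 1 ≠ 0 := by
    intro h0
    rw [sub_eq_zero.mp h0] at hi
    apply h2
    linear_combination hi
  set m := i * (p + 1) / (p - 1) with hm
  have hmp : m * (p - 1) = i * (p + 1) := div_mul_cancel₀ _ hp1'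
  have e1 : (m - 1) * (p - 1) = (i - 1) * (p - i) := by linear_combination hmp + hi
  have e2 : (m + 1) * (p - 1) = (i + 1) * (p + i) := by linear_combination hmp - hi
  have hm1 : m ≠ 1 := by
    intro h0
    rw [h0, sub_self, zero_mul] at e1
    exact mul_ne_zero hi1 (sub_ne_zero.mpr hpi) e1.symm
  refine hF.of_rot hi (hF.rot p hp1 hp) hm1 ?_
  rw [← hm]
  refine mul_right_cancel₀ (pow_ne_zero 2 hp1') ?_
  have e3 : (i + 1) ^ 2 = -(i - 1) ^ 2 := by linear_combination 2 * hi
  calc (q ^ 2 * (m - 1) ^ 2 + (m + 1) ^ 2) * (p - 1) ^ 2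
      = q ^ 2 * ((m - 1) * (p - 1)) ^ 2 + ((m + 1) * (p - 1)) ^ 2 := by ring
    _ = (i - 1) ^ 2 * (q ^ 2 * (p - i) ^ 2 - (p + i) ^ 2) := by
        rw [e1, e2, mul_pow (i + 1), e3]; ring
    _ = 0 * (p - 1) ^ 2 := by rw [h]; ring

/-- The rotation sends 0 to -i, i to 1 and -1 to 0. With sign changes this links all finite vertices
of the octahedron without passing through ∞. -/
lemma eval_zero_iff (hF : TetrahedralRoots i F) (hi : i ^ 2 = -1) (h2 : (2 : k) ≠ 0) {p : k}
    (hp : (polyR k).eval p = 0) : F.eval p = 0 ↔ F.eval 0 = 0 := by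
  have hi0 := ne_zero_of_sq hi
  have hi1 : i ≠ 1 := by
    rintro rfl
    apply h2
    linear_combination hi
  have h1n : (-1 : k) ≠ 1 := fun h => h2 (by linear_combination -h)
  have hneg : ∀ p, F.eval (-p) = 0 ↔ F.eval p = 0 := fun p =>
    ⟨fun h => by simpa using hF.neg _ h, hF.neg p⟩
  have hz : F.eval 0 = 0 → F.eval i = 0 := fun h => by
    refine hF.of_rot hi h zero_ne_one ?_
    linear_combination hi
  have hii : F.eval i = 0 → F.eval 1 = 0 := fun h => by
    refine hF.of_rot hi h hi1 ?_
    linear_combination 2 * hi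
  have h10 : F.eval 1 = 0 → F.eval 0 = 0 := fun h => by
    refine hF.of_rot hi ((hneg 1).mpr h) h1n ?_
    ring
  have key : F.eval 1 = 0 ↔ F.eval 0 = 0 := ⟨h10, hii ∘ hz⟩
  have keyi : F.eval i = 0 ↔ F.eval 0 = 0 := ⟨h10 ∘ hii, hz⟩
  rw [eval_polyR] at hp
  rcases mul_eq_zero.mp hp with rfl | hp
  · rfl
  · have : (p ^ 2 - 1 ^ 2) * (p ^ 2 - i ^ 2) = 0 := by
      linear_combination hp - (p ^ 2 - 1) * hi
    rcases mul_eq_zero.mp this with h | h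
    · rcases sq_eq_sq_iff_eq_or_eq_neg.mp (sub_eq_zero.mp h) with rfl | rfl
      · exact key
      · exact (hneg 1).trans key
    · rcases sq_eq_sq_iff_eq_or_eq_neg.mp (sub_eq_zero.mp h) with rfl | rfl
      · exact keyi
      · exact (hneg i).trans keyi

/-- As a polynomial in q, N(q)R(p)² - N(p)R(q)² is the product of six quadratics. Each is the
equation of one pair ±q in the A₄-orbit of p, and R(p) ≠ 0 keeps that orbit away from ∞. -/
lemma eval_eq_zero_of_orbitPoly (hF : TetrahedralRoots i F) (hi : i ^ 2 = -1) (h2 : (2 : k) ≠ 0)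
    {a p q : k} (hp : F.eval p = 0) (hR : (polyR k).eval p ≠ 0) (hGp : (orbitPoly a).eval p = 0)
    (hGq : (orbitPoly a).eval q = 0) : F.eval q = 0 := by
  rw [eval_orbitPoly, eval_polyR] at hGp hGq
  rw [eval_polyR] at hR
  have hp1 : p ≠ 1 := by rintro rfl; simp at hR
  have hp1' : -p ≠ 1 := by
    intro h
    rw [neg_eq_iff_eq_neg.mp h] at hR
    apply hR; ring
  have hpi : p ≠ i := by
    rintro rfl
    apply hR
    linear_combination p * (p ^ 2 - 1) * hi
  have hpi' : -p ≠ i := by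
    rintro rfl
    apply hR
    linear_combination p * (p ^ 2 - 1) * hi
  -- This product is even in i, so i can be eliminated before the comparison with the pencil.
  have hq1 : (q ^ 2 * (p - i) ^ 2 - (p + i) ^ 2) * (q ^ 2 * (-p - i) ^ 2 - (-p + i) ^ 2)
      = q ^ 4 * (p ^ 2 + 1) ^ 2 - q ^ 2 * (2 * p ^ 4 - 12 * p ^ 2 + 2) + (p ^ 2 + 1) ^ 2 := by
    have h4 : i ^ 4 = 1 := by linear_combination (i ^ 2 - 1) * hi
    linear_combination (-2 * q ^ 4 * p ^ 2 - 12 * q ^ 2 * p ^ 2 - 2 * p ^ 2) * hi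
      + (q ^ 4 - 2 * q ^ 2 + 1) * h4
  have key : (q ^ 2 - p ^ 2) * (q ^ 2 * p ^ 2 - 1) *
      ((q ^ 2 * (p - i) ^ 2 - (p + i) ^ 2) * (q ^ 2 * (-p - i) ^ 2 - (-p + i) ^ 2)) *
      ((q ^ 2 * (p - 1) ^ 2 + (p + 1) ^ 2) * (q ^ 2 * (-p - 1) ^ 2 + (-p + 1) ^ 2)) = 0 := by
    rw [hq1]
    linear_combination (p * (p ^ 4 - 1)) ^ 2 * hGq - (q * (q ^ 4 - 1)) ^ 2 * hGp
  have hnp := hF.neg p hp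
  rcases mul_eq_zero.mp key with h | h
  · rcases mul_eq_zero.mp h with h | h
    · rcases mul_eq_zero.mp h with h | h
      · exact hF.of_sq_eq hp (sub_eq_zero.mp h)
      · exact hF.of_sq_mul_sq hp (sub_eq_zero.mp h)
    · rcases mul_eq_zero.mp h with h | h
      · exact hF.of_rot_rot hi h2 hp hp1 hpi h
      · exact hF.of_rot_rot hi h2 hnp hp1' hpi' h
  · rcases mul_eq_zero.mp h with h | h
    · exact hF.of_rot hi hp hp1 h
    · exact hF.of_rot hi hnp hp1' h

/-- A squarefree polynomial with tetrahedral roots is a product of the orbit polynomials. -/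
theorem exists_factorization [IsAlgClosed k] [CharZero k] (hF : TetrahedralRoots i F)
    (hi : i ^ 2 = -1) {r : k} (hr : r ^ 2 = 3) (hsq : Squarefree F) :
    ∃ (u : k) (A B D : k[X]) (δ : ℕ) (lam : Fin δ → k), u ≠ 0 ∧ Function.Injective lam ∧
      (∀ j, lam j ^ 2 + 108 ≠ 0) ∧ (F.eval 0 ≠ 0 ∧ A = 1 ∨ F.eval 0 = 0 ∧ A = polyR k) ∧
      (B = 1 ∨ B = polyT i r) ∧ (D = 1 ∨ D = polyT (-i) r) ∧
      F = Polynomial.C u * (A * B * D * orbitProd lam) := by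
  classical
  have h2 : (2 : k) ≠ 0 := two_ne_zero
  have hi' : (-i) ^ 2 = -1 := by rw [neg_sq, hi]
  have hF0 := hsq.ne_zero
  obtain ⟨A, hA, hAF, hFA, hAR⟩ : ∃ A, (F.eval 0 ≠ 0 ∧ A = 1 ∨ F.eval 0 = 0 ∧ A = polyR k) ∧
      A ∣ F ∧ (∀ p, F.eval p = 0 → (polyR k).eval p = 0 → A.eval p = 0) ∧ A ∣ polyR k := by
    by_cases h0 : F.eval 0 = 0
    · exact ⟨polyR k, Or.inr ⟨h0, rfl⟩, dvd_of_squarefree_of_eval squarefree_polyR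
        fun p hp => (hF.eval_zero_iff hi h2 hp).mpr h0, fun _ _ h => h, dvd_rfl⟩
    · exact ⟨1, Or.inl ⟨h0, rfl⟩, one_dvd _,
        fun p hp hR => absurd ((hF.eval_zero_iff hi h2 hR).mp hp) h0, one_dvd _⟩
  have hT : ∀ j : k, j ^ 2 = -1 → ∃ B, (B = 1 ∨ B = polyT j r) ∧ B ∣ F ∧
      (∀ p, F.eval p = 0 → (polyT j r).eval p = 0 → B.eval p = 0) ∧ B ∣ polyT j r := by
    intro j hj
    by_cases h : ∃ p, F.eval p = 0 ∧ (polyT j r).eval p = 0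
    · obtain ⟨p, hp, hTp⟩ := h
      exact ⟨polyT j r, Or.inr rfl, dvd_of_squarefree_of_eval (squarefree_polyT hj hr)
        fun q hq => hF.eval_eq_zero_of_polyT hp hTp hq, fun _ _ h => h, dvd_rfl⟩
    · exact ⟨1, Or.inl rfl, one_dvd _, fun p hp hTp => absurd ⟨p, hp, hTp⟩ h, one_dvd _⟩
  obtain ⟨B, hB, hBF, hFB, hBT⟩ := hT i hi
  obtain ⟨D, hD, hDF, hFD, hDT⟩ := hT (-i) hi'
  -- These are the roots on no special orbit. Their images under N/R² are the parameters λ.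
  let Ω : Finset k := F.roots.toFinset.filter fun p => (polyR k).eval p ≠ 0 ∧
    (polyT i r).eval p ≠ 0 ∧ (polyT (-i) r).eval p ≠ 0
  let inv : k → k := fun p =>
    (p ^ 12 - 33 * p ^ 8 - 33 * p ^ 4 + 1) / (polyR k).eval p ^ 2
  have hΩ : ∀ p, p ∈ Ω ↔ F.eval p = 0 ∧ (polyR k).eval p ≠ 0 ∧
      (polyT i r).eval p ≠ 0 ∧ (polyT (-i) r).eval p ≠ 0 := fun p => by
    simp [Ω, hF0]
  have hinv : ∀ p, (polyR k).eval p ≠ 0 → (orbitPoly (inv p)).eval p = 0 := fun p hp => by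
    rw [eval_orbitPoly, div_mul_cancel₀ _ (pow_ne_zero 2 hp), sub_self]
  let Λ := Ω.image inv
  have hΛ : ∀ a ∈ Λ, a ^ 2 + 108 ≠ 0 := by
    intro a ha
    obtain ⟨p, hp, rfl⟩ := Finset.mem_image.mp ha
    obtain ⟨-, hR, hTp, hSp⟩ := (hΩ p).mp hp
    intro h0
    -- λ = ∓6ir would make p a root of T³ or of S³.
    have h1 : (inv p + 6 * i * r) * (inv p - 6 * i * r) = 0 := by
      linear_combination h0 - sq_add_eq_zero hi hr
    have hG := hinv p hR
    rw [eval_orbitPoly] at hG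
    rcases mul_eq_zero.mp h1 with h | h
    · have := eval_polyT_pow_three hi hr p
      refine hTp (pow_eq_zero_iff three_ne_zero |>.mp (this.trans ?_))
      linear_combination hG + (polyR k).eval p ^ 2 * h
    · have := eval_polyT_pow_three hi' hr p
      refine hSp (pow_eq_zero_iff three_ne_zero |>.mp (this.trans ?_))
      linear_combination hG + (polyR k).eval p ^ 2 * h
  have hΛF : ∀ a ∈ Λ, orbitPoly a ∣ F := by
    intro a ha
    have ha' := hΛ a ha
    obtain ⟨p, hp, rfl⟩ := Finset.mem_image.mp ha
    obtain ⟨hFp, hR, -, -⟩ := (hΩ p).mp hp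
    exact dvd_of_squarefree_of_eval (squarefree_orbitPoly hi hr ha')
      fun q hq => hF.eval_eq_zero_of_orbitPoly hi h2 hFp hR (hinv p hR) hq
  set G : k[X] := ∏ a ∈ Λ, orbitPoly a with hG
  have hGF : G ∣ F := Finset.prod_dvd_of_coprime
    (fun a _ b _ hab => isCoprime_of_eval_ne_zero fun p hp => eval_orbitPoly_ne_zero_of_ne hab hp)
    hΛF
  have cAB : IsCoprime A B := (isCoprime_of_eval_ne_zero (P := polyR k) (Q := polyT i r)
    fun p hp => eval_polyT_ne_zero_of_polyR hi hr hp).mono hAR hBT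
  have cABD : IsCoprime (A * B) D := IsCoprime.mul_left
    ((isCoprime_of_eval_ne_zero (P := polyR k) (Q := polyT (-i) r)
      fun p hp => eval_polyT_ne_zero_of_polyR hi' hr hp).mono hAR hDT)
    ((isCoprime_of_eval_ne_zero (P := polyT i r) (Q := polyT (-i) r)
      fun p hp => eval_polyT_neg_ne_zero hi hr hp).mono hBT hDT)
  have cG : IsCoprime (A * B * D) G := by
    refine IsCoprime.prod_right fun a ha => IsCoprime.mul_left (IsCoprime.mul_left ?_ ?_) ?_
    · exact (isCoprime_of_eval_ne_zero fun p hp =>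
        eval_orbitPoly_ne_zero_of_polyR hp).mono hAR dvd_rfl
    · exact (isCoprime_of_eval_ne_zero fun p hp =>
        eval_polyT_ne_zero_of_orbitPoly hi hr (hΛ a ha) hp).symm.mono hBT dvd_rfl
    · exact (isCoprime_of_eval_ne_zero fun p hp =>
        eval_polyT_ne_zero_of_orbitPoly hi' hr (hΛ a ha) hp).symm.mono hDT dvd_rfl
  have hdvd : A * B * D * G ∣ F :=
    cG.mul_dvd (cABD.mul_dvd (cAB.mul_dvd hAF hBF) hDF) hGF
  have hdvd' : F ∣ A * B * D * G := by
    refine dvd_of_squarefree_of_eval hsq fun p hp => ?_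
    simp only [eval_mul, mul_eq_zero]
    by_cases hR : (polyR k).eval p = 0
    · exact Or.inl (Or.inl (Or.inl (hFA p hp hR)))
    by_cases hTp : (polyT i r).eval p = 0
    · exact Or.inl (Or.inl (Or.inr (hFB p hp hTp)))
    by_cases hSp : (polyT (-i) r).eval p = 0
    · exact Or.inl (Or.inr (hFD p hp hSp))
    · right
      rw [hG, eval_prod]
      exact Finset.prod_eq_zero
        (Finset.mem_image_of_mem inv ((hΩ p).mpr ⟨hp, hR, hTp, hSp⟩)) (hinv p hR)
  obtain ⟨v, hv⟩ := associated_of_dvd_dvd hdvd hdvd'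
  obtain ⟨u, hu, huv⟩ := Polynomial.isUnit_iff.mp v.isUnit
  refine ⟨u, A, B, D, Λ.card, fun j => (Λ.equivFin.symm j : k), hu.ne_zero,
    Subtype.val_injective.comp Λ.equivFin.symm.injective,
    fun j => hΛ _ (Λ.equivFin.symm j).2, hA, hB, hD, ?_⟩
  have hprod : orbitProd (fun j => (Λ.equivFin.symm j : k)) = G := by
    rw [orbitProd, Equiv.prod_comp Λ.equivFin.symm (fun a : Λ => orbitPoly (a : k)), hG,
      Finset.prod_coe_sort Λ orbitPoly]
  rw [hprod, ← hv, ← huv, mul_comm]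

end TetrahedralRoots

end Factorization

/-! ### Effect of X ↦ -X and X ↦ iX on the orbit polynomials, and their degrees. -/

section Substitutions

variable {k : Type*} [Field k]

lemma orbitProd_comp {δ : ℕ} (lam : Fin δ → k) (P : k[X]) :
    (orbitProd lam).comp P = ∏ j, (orbitPoly (lam j)).comp P := by
  rw [orbitProd, prod_comp]

lemma orbitProd_comp_neg {δ : ℕ} (lam : Fin δ → k) :
    (orbitProd lam).comp (-X) = orbitProd lam := by
  rw [orbitProd_comp, orbitProd]
  refine Finset.prod_congr rfl fun j _ => ?_
  simp only [orbitPoly, add_comp, sub_comp, mul_comp, X_pow_comp, C_comp, ofNat_comp, one_comp]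
  ring

lemma polyR_comp_neg : (polyR k).comp (-X) = -polyR k := by
  simp only [polyR, sub_comp, mul_comp, X_pow_comp, X_comp, one_comp]
  ring

lemma polyT_comp_neg (i r : k) : (polyT i r).comp (-X) = polyT i r := by
  simp only [polyT, add_comp, mul_comp, X_pow_comp, C_comp, one_comp]
  ring

lemma polyST_comp_neg : (polyST k).comp (-X) = polyST k := by
  simp only [polyST, add_comp, mul_comp, X_pow_comp, ofNat_comp, one_comp]
  ring

variable {i : k}

lemma polyR_comp_quarter (hi : i ^ 2 = -1) :
    (polyR k).comp (C i * X + C 0) = C i * polyR k := by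
  have h : C i ^ 4 = (1 : k[X]) := by
    rw [← map_pow, show i ^ 4 = (i ^ 2) ^ 2 by ring, hi]; simp
  simp only [polyR, sub_comp, mul_comp, X_pow_comp, X_comp, one_comp, map_zero]
  linear_combination C i * X ^ 5 * h

/-- X ↦ iX lies in the octahedral group, which normalises A₄ and exchanges its two orbits of four
points. This removes the case where S occurs without T. -/
lemma polyT_neg_comp_quarter (hi : i ^ 2 = -1) (r : k) :
    (polyT (-i) r).comp (C i * X + C 0) = polyT i r := by
  have h : C i ^ 2 = (-1 : k[X]) := by rw [← map_pow, hi]; simp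
  simp only [polyT, add_comp, mul_comp, X_pow_comp, C_comp, one_comp, neg_comp,
    map_zero, map_mul, map_neg]
  linear_combination ((C i ^ 2 - 1) * X ^ 4 - C 2 * C i * C r * X ^ 2) * h

lemma polyST_comp_quarter (hi : i ^ 2 = -1) :
    (polyST k).comp (C i * X + C 0) = polyST k := by
  have h : C i ^ 4 = (1 : k[X]) := by
    rw [← map_pow, show i ^ 4 = (i ^ 2) ^ 2 by ring, hi]; simp
  simp only [polyST, add_comp, mul_comp, X_pow_comp, ofNat_comp, one_comp, map_zero]
  linear_combination ((C i ^ 4 + 1) * X ^ 8 + 14 * X ^ 4) * h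

lemma orbitPoly_comp_quarter (hi : i ^ 2 = -1) (a : k) :
    (orbitPoly a).comp (C i * X + C 0) = orbitPoly (-a) := by
  have h : C i ^ 2 = (-1 : k[X]) := by rw [← map_pow, hi]; simp
  have h4 : C i ^ 4 = (1 : k[X]) := by linear_combination (C i ^ 2 - 1) * h
  have h6 : C i ^ 6 = (-1 : k[X]) := by linear_combination C i ^ 2 * h4 + h
  have h8 : C i ^ 8 = (1 : k[X]) := by linear_combination (C i ^ 4 + 1) * h4
  have h10 : C i ^ 10 = (-1 : k[X]) := by linear_combination C i ^ 2 * h8 + h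
  have h12 : C i ^ 12 = (1 : k[X]) := by linear_combination C i ^ 4 * h8 + h4
  simp only [orbitPoly, add_comp, sub_comp, mul_comp, X_pow_comp, C_comp, ofNat_comp, one_comp,
    map_zero, add_zero, mul_pow, h, h4, h6, h8, h10, h12, mul_neg, map_neg]
  ring

lemma orbitProd_comp_quarter (hi : i ^ 2 = -1) {δ : ℕ} (lam : Fin δ → k) :
    (orbitProd lam).comp (C i * X + C 0) = orbitProd (fun j => -lam j) := by
  rw [orbitProd_comp, orbitProd]
  exact Finset.prod_congr rfl fun j _ => orbitPoly_comp_quarter hi _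

lemma natDegree_orbitProd {δ : ℕ} (lam : Fin δ → k) : (orbitProd lam).natDegree = 12 * δ := by
  have h : ∀ a : k, (orbitPoly a).natDegree = 12 := fun a => by
    unfold orbitPoly; compute_degree!
  have h0 : ∀ a : k, orbitPoly a ≠ 0 := fun a h1 => by
    have := h a
    rw [h1, natDegree_zero] at this
    omega
  rw [orbitProd, natDegree_prod _ _ fun j _ => h0 _]
  simp [h, mul_comm]

lemma natDegree_polyR : (polyR k).natDegree = 5 := by
  have : polyR k = X ^ 5 - X := by rw [polyR]; ring
  rw [this]; compute_degree!

lemma natDegree_polyT (i r : k) : (polyT i r).natDegree = 4 := by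
  unfold polyT; compute_degree!

lemma natDegree_polyST : (polyST k).natDegree = 8 := by
  unfold polyST; compute_degree!

end Substitutions

/-! ### Standard form of the equation, and the lifts of X ↦ -X and X ↦ iX. -/

namespace HyperellipticCurve

variable {k K : Type*} [Field k] [Field K] [Algebra k K] {g : ℕ}

/-- In a suitable coordinate the branch polynomial is a product of orbit polynomials. -/
lemma exists_standard_form [CharZero k] [IsAlgClosed k] (C : HyperellipticCurve k K g)
    {σ : K ≃ₐ[k] K} (hσ : σ C.x = -C.x) {i r : k} (hi : i ^ 2 = -1) (hr : r ^ 2 = 3)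
    (hF : TetrahedralRoots i C.F) (h0 : C.F.eval 0 = 0 ↔ C.F.natDegree = 2 * g + 1) :
    ∃ (C' : HyperellipticCurve k K g) (A E : k[X]) (δ : ℕ) (lam : Fin δ → k),
      C'.rationalSubfield = C.rationalSubfield ∧ σ C'.x = -C'.x ∧
      Function.Injective lam ∧ (∀ j, lam j ^ 2 + 108 ≠ 0) ∧
      (A = 1 ∧ C'.F.natDegree = 2 * g + 2 ∨ A = polyR k ∧ C'.F.natDegree = 2 * g + 1) ∧
      (E = 1 ∨ E = polyT i r ∨ E = polyST k) ∧ C'.F = A * E * orbitProd lam := by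
  -- The constant factor u is absorbed by rescaling y with a square root of 1/u.
  suffices H : ∃ (C' : HyperellipticCurve k K g) (u : k) (A E : k[X]) (δ : ℕ) (lam : Fin δ → k),
      u ≠ 0 ∧ C'.rationalSubfield = C.rationalSubfield ∧ σ C'.x = -C'.x ∧
      Function.Injective lam ∧ (∀ j, lam j ^ 2 + 108 ≠ 0) ∧
      (A = 1 ∧ C'.F.natDegree = 2 * g + 2 ∨ A = polyR k ∧ C'.F.natDegree = 2 * g + 1) ∧
      (E = 1 ∨ E = polyT i r ∨ E = polyST k) ∧
      C'.F = Polynomial.C u * (A * E * orbitProd lam) by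
    obtain ⟨C', u, A, E, δ, lam, hu, hC', hσ', hlam, hlam', hA, hE, hF'⟩ := H
    obtain ⟨e, he⟩ := IsAlgClosed.exists_pow_nat_eq u⁻¹ (n := 2) (by norm_num)
    have he0 : e ≠ 0 := by
      rintro rfl
      rw [zero_pow two_ne_zero] at he
      exact inv_ne_zero hu he.symm
    refine ⟨C'.scale e he0, A, E, δ, lam, hC', hσ', hlam, hlam', ?_, hE, ?_⟩
    · rwa [scale_F, natDegree_C_mul (pow_ne_zero 2 he0)]
    · rw [scale_F, hF', he, ← mul_assoc, ← map_mul, inv_mul_cancel₀ hu, map_one, one_mul]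
  obtain ⟨u, A, B, D, δ, lam, hu, hlam, hlam', hA, hB, hD, hFe⟩ :=
    hF.exists_factorization hi hr C.squarefree
  have hA' : A = 1 ∧ C.F.natDegree = 2 * g + 2 ∨ A = polyR k ∧ C.F.natDegree = 2 * g + 1 := by
    rcases hA with ⟨h, hA⟩ | ⟨h, hA⟩
    · exact Or.inl ⟨hA, C.natDegree_eq.resolve_left (mt h0.mpr h)⟩
    · exact Or.inr ⟨hA, h0.mp h⟩
  rcases hB with rfl | rfl <;> rcases hD with rfl | rfl
  · exact ⟨C, u, A, 1, δ, lam, hu, rfl, hσ, hlam, hlam', hA', Or.inl rfl, by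
      rw [hFe, mul_one, mul_one]⟩
  -- Only S occurs. The coordinate x/i turns it into T and negates every λ.
  · have hi0 := ne_zero_of_sq hi
    obtain ⟨v, hv, hAv⟩ : ∃ v : k, v ≠ 0 ∧
        A.comp (Polynomial.C i * X + Polynomial.C 0) = Polynomial.C v * A := by
      rcases hA with ⟨-, rfl⟩ | ⟨-, rfl⟩
      · exact ⟨1, one_ne_zero, by simp⟩
      · exact ⟨i, hi0, polyR_comp_quarter hi⟩
    refine ⟨C.affine i 0 hi0, u * v, A, polyT i r, δ, fun j => -lam j, mul_ne_zero hu hv,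
      C.affine_rationalSubfield _ _ _, ?_, neg_injective.comp hlam, fun j => ?_, ?_,
      Or.inr (Or.inl rfl), ?_⟩
    · rw [affine_x, map_mul, map_sub, AlgEquiv.commutes, AlgEquiv.commutes, hσ, map_zero]
      ring
    · rw [neg_sq]; exact hlam' j
    · rwa [affine_F, natDegree_comp, natDegree_linear hi0, mul_one]
    · rw [affine_F, hFe, mul_comp, mul_comp, mul_comp, mul_comp, C_comp, hAv, one_comp,
        polyT_neg_comp_quarter hi, orbitProd_comp_quarter hi, map_mul]
      ring
  · exact ⟨C, u, A, polyT i r, δ, lam, hu, rfl, hσ, hlam, hlam', hA', Or.inr (Or.inl rfl), by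
      rw [hFe, mul_one]⟩
  · exact ⟨C, u, A, polyST k, δ, lam, hu, rfl, hσ, hlam, hlam', hA', Or.inr (Or.inr rfl), by
      rw [hFe, mul_assoc A, polyT_mul_polyT_neg hi hr]⟩

/-- σ y = ±e·y, and both signs give the same σ²y. With e = 1 the lift has order two; with e = i its
square is the hyperelliptic involution. -/
lemma involution_lift_sq_apply (C : HyperellipticCurve k K g) {σ : K ≃ₐ[k] K}
    (hσ : σ C.x = -C.x) {e : k} (hF : C.F.comp (-X) = Polynomial.C (e ^ 2) * C.F) :
    σ (σ C.y) = algebraMap k K (e ^ 2) * C.y := by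
  have h : σ C.y ^ 2 = (algebraMap k K e * C.y) ^ 2 := by
    rw [← map_pow, C.equation, ← Polynomial.aeval_algHom_apply σ, hσ, mul_pow, C.equation,
      ← map_pow, show aeval (-C.x) C.F = aeval C.x (C.F.comp (-X)) by
        rw [aeval_comp, map_neg, aeval_X], hF, map_mul, aeval_C]
  rcases sq_eq_sq_iff_eq_or_eq_neg.mp h with h | h
  · rw [h, map_mul, AlgEquiv.commutes, h, map_pow]; ring
  · rw [h, map_neg, map_mul, AlgEquiv.commutes, h, map_pow]; ring

/-- The automorphism `X ↦ iX` has order divisible by four modulo the hyperelliptic involution. -/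
lemma exists_pow_six_notMem [CharZero k] [IsAlgClosed k] (C : HyperellipticCurve k K g) {i : k}
    (hi : i ^ 2 = -1) {v : k} (hv : v ≠ 0)
    (hF : C.F.comp (Polynomial.C i * X + Polynomial.C 0) = Polynomial.C v * C.F) :
    ∃ σ : K ≃ₐ[k] K, σ ^ 6 ∉ C.hyperellipticSubgroup := by
  have : CharZero K := charZero_of_injective_algebraMap (algebraMap k K).injective
  have hi0 := ne_zero_of_sq hi
  obtain ⟨e, he⟩ := IsAlgClosed.exists_pow_nat_eq v⁻¹ (n := 2) (by norm_num)
  have he0 : e ≠ 0 := by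
    rintro rfl
    rw [zero_pow two_ne_zero] at he
    exact inv_ne_zero hv he.symm
  obtain ⟨σ, hσ, -⟩ := C.exists_algEquiv ((C.affine i 0 hi0).scale e he0) (by
    rw [scale_F, affine_F, hF, he, ← mul_assoc, ← map_mul, inv_mul_cancel₀ hv, map_one, one_mul])
  rw [scale_x, affine_x, map_zero, sub_zero] at hσ
  refine ⟨σ, fun h => ?_⟩
  rw [mem_hyperellipticSubgroup_iff] at h
  have hpow : ∀ n : ℕ, (σ ^ n) C.x = algebraMap k K (i⁻¹ ^ n) * C.x := by
    intro n
    induction n with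
    | zero => simp
    | succ n ih =>
      rw [pow_succ', AlgEquiv.mul_apply, ih, map_mul, AlgEquiv.commutes, hσ, ← mul_assoc,
        ← map_mul, pow_succ]
  have h6 : i⁻¹ ^ 6 = -1 := by
    rw [inv_pow, show i ^ 6 = (i ^ 2) ^ 3 by ring, hi]; norm_num
  rw [hpow, h6, map_neg, map_one, neg_one_mul] at h
  exact C.x_ne_zero (self_eq_neg.mp h.symm)

end HyperellipticCurve

/-! ### The six cases. -/

theorem lemma4p2 {k K : Type*} [Field k] [IsAlgClosed k] [CharZero k] [Field K] [Algebra k K]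
    {g : ℕ} (C : HyperellipticCurve k K g)
    (hA : Nonempty (C.ReducedAut ≃* alternatingGroup (Fin 4)))
    (i r : k) (hi : i ^ 2 = -1) (hr : r ^ 2 = 3) :
    ∃ (δ : ℕ) (lam : Fin δ → k), Function.Injective lam ∧ (∀ j, lam j ^ 2 + 108 ≠ 0) ∧
      ((Nonempty ((K ≃ₐ[k] K) ≃* Multiplicative (ZMod 2) × alternatingGroup (Fin 4)) ∧
          g + 1 = 6 * δ ∧
          HasHyperellipticEquation k K g (orbitProd lam)) ∨
        (Nonempty ((K ≃ₐ[k] K) ≃* Multiplicative (ZMod 2) × alternatingGroup (Fin 4)) ∧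
          g = 6 * δ + 1 ∧
          HasHyperellipticEquation k K g (polyT i r * orbitProd lam)) ∨
        (Nonempty ((K ≃ₐ[k] K) ≃* Multiplicative (ZMod 2) × alternatingGroup (Fin 4)) ∧
          g = 6 * δ + 3 ∧ δ ≠ 0 ∧
          HasHyperellipticEquation k K g (polyST k * orbitProd lam)) ∨
        (Nonempty ((K ≃ₐ[k] K) ≃* Matrix.SpecialLinearGroup (Fin 2) (ZMod 3)) ∧
          g = 6 * δ + 2 ∧ δ ≠ 0 ∧
          HasHyperellipticEquation k K g (polyR k * orbitProd lam)) ∨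
        (Nonempty ((K ≃ₐ[k] K) ≃* Matrix.SpecialLinearGroup (Fin 2) (ZMod 3)) ∧
          g = 6 * δ + 4 ∧
          HasHyperellipticEquation k K g (polyR k * polyT i r * orbitProd lam)) ∨
        (Nonempty ((K ≃ₐ[k] K) ≃* Matrix.SpecialLinearGroup (Fin 2) (ZMod 3)) ∧
          g = 6 * δ + 6 ∧ δ ≠ 0 ∧
          HasHyperellipticEquation k K g (polyR k * polyST k * orbitProd lam))) := by
  have : CharZero K := charZero_of_injective_algebraMap (algebraMap k K).injective
  obtain ⟨f⟩ := hA
  obtain ⟨z, -, hz1, hz⟩ := C.exists_involution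
  obtain ⟨n, I, J, T, hn, hrel, hgen, hI, hJ, hIJ, hcard⟩ :=
    exists_tetrahedralRelations C.hyperellipticSubgroup f hz1 hz
  obtain ⟨C₁, hC₁, hI₁, hroots, h0⟩ := C.exists_tetrahedral_coordinate hrel
    ((hz z).mpr (Or.inr rfl)) hI hJ hIJ hi
  obtain ⟨C₂, A, E, δ, lam, hC₂, hI₂, hlam, hlam', hAdeg, hE, hF⟩ :=
    C₁.exists_standard_form hI₁ hi hr hroots h0
  -- Semi-invariance under X ↦ iX would produce an automorphism whose sixth power is nontrivial in
  -- the reduced group, whereas x⁶ = 1 in A₄.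
  have hsix : ∀ v : k, v ≠ 0 →
      C₂.F.comp (Polynomial.C i * X + Polynomial.C 0) ≠ Polynomial.C v * C₂.F := by
    intro v hv h
    obtain ⟨σ, hσ⟩ := C₂.exists_pow_six_notMem hi hv h
    apply hσ
    rw [HyperellipticCurve.hyperellipticSubgroup, hC₂, hC₁,
      ← HyperellipticCurve.hyperellipticSubgroup, ← QuotientGroup.eq_one_iff,
      QuotientGroup.mk_pow]
    exact f.injective (by rw [map_pow, map_one, alternatingGroup_four_pow_six])
  have hIx : (I * I) C₂.x = C₂.x := by rw [AlgEquiv.mul_apply, hI₂, map_neg, hI₂, neg_neg]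
  have hEneg : E.comp (-X) = E := by
    rcases hE with rfl | rfl | rfl
    · exact one_comp
    · exact polyT_comp_neg i r
    · exact polyST_comp_neg
  have hlam0 : δ = 0 → orbitProd lam = 1 := by
    rintro rfl
    simp [orbitProd]
  have hEG : E * orbitProd lam ≠ 0 := fun h =>
    C₂.squarefree.ne_zero (by rw [hF, mul_assoc, h, mul_zero])
  have hEGdeg : (E * orbitProd lam).natDegree = E.natDegree + 12 * δ := by
    rw [natDegree_mul (left_ne_zero_of_mul hEG) (right_ne_zero_of_mul hEG), natDegree_orbitProd]
  have hg := C₂.two_le_genus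
  rcases hAdeg with ⟨rfl, hdeg⟩ | ⟨rfl, hdeg⟩
  -- Without the factor R, F is even, so I² fixes y as well as x.
  · have hII : I * I = 1 := by
      refine C₂.algEquiv_ext hIx ?_
      have := C₂.involution_lift_sq_apply hI₂ (e := 1) (by
        rw [hF, mul_comp, mul_comp, hEneg, orbitProd_comp_neg, one_comp]; simp)
      simpa using this
    have hn0 : n = 0 := by
      have h1 := hrel.I_mul_self
      rw [hII] at h1
      interval_cases n
      · rfl
      · exact absurd (by simpa using h1.symm) hz1
    subst hn0
    have hiso := hrel.nonempty_mulEquiv product_relations.1 hgen product_relations.2 hcard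
      (by rw [Nat.card_prod, nat_card_alternatingGroup]; simp [Nat.factorial])
    rw [one_mul] at hF
    rw [hF, hEGdeg] at hdeg
    refine ⟨δ, lam, hlam, hlam', ?_⟩
    rcases hE with rfl | rfl | rfl
    · rw [natDegree_one] at hdeg
      exact Or.inl ⟨hiso, by omega, C₂, by rw [hF, one_mul]⟩
    · rw [natDegree_polyT] at hdeg
      exact Or.inr (Or.inl ⟨hiso, by omega, C₂, hF⟩)
    · rw [natDegree_polyST] at hdeg
      -- With δ = 0, F = ST would be invariant under X ↦ iX.
      refine Or.inr (Or.inr (Or.inl ⟨hiso, by omega, fun hδ => ?_, C₂, hF⟩))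
      rw [hlam0 hδ, mul_one] at hF
      exact hsix 1 one_ne_zero (by rw [hF, polyST_comp_quarter hi, map_one, one_mul])
  -- With the factor R, F is odd, so I² sends y to -y.
  · have hII : I * I ≠ 1 := by
      intro h
      have h1 := C₂.involution_lift_sq_apply hI₂ (e := i) (by
        rw [hF, mul_comp, mul_comp, hEneg, orbitProd_comp_neg, polyR_comp_neg, hi]; simp)
      rw [← AlgEquiv.mul_apply, h, hi, AlgEquiv.one_apply, map_neg, map_one, neg_one_mul] at h1
      exact C₂.y_ne_zero (self_eq_neg.mp h1)
    have hn1 : n = 1 := by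
      have h1 := hrel.I_mul_self
      interval_cases n
      · exact absurd h1 hII
      · rfl
    subst hn1
    have hiso := hrel.nonempty_mulEquiv specialLinearGroup_relations.1 hgen
      specialLinearGroup_relations.2 hcard card_specialLinearGroup
    have hR : polyR k ≠ 0 := fun h => C₂.squarefree.ne_zero (by rw [hF, h, zero_mul, zero_mul])
    rw [hF, mul_assoc, natDegree_mul hR hEG, hEGdeg, natDegree_polyR] at hdeg
    refine ⟨δ, lam, hlam, hlam', ?_⟩
    have hi0 := ne_zero_of_sq hi
    rcases hE with rfl | rfl | rfl
    · rw [natDegree_one] at hdeg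
      rw [mul_one] at hF
      -- R(iX) = iR(X), so δ = 0 is impossible here, and likewise for R·ST. For R·T it is allowed,
      -- since X ↦ iX carries T to S.
      refine Or.inr (Or.inr (Or.inr (Or.inl ⟨hiso, by omega, fun hδ => ?_, C₂, hF⟩)))
      rw [hlam0 hδ, mul_one] at hF
      exact hsix i hi0 (by rw [hF, polyR_comp_quarter hi])
    · rw [natDegree_polyT] at hdeg
      exact Or.inr (Or.inr (Or.inr (Or.inr (Or.inl ⟨hiso, by omega, C₂, hF⟩))))
    · rw [natDegree_polyST] at hdeg
      refine Or.inr (Or.inr (Or.inr (Or.inr (Or.inr ⟨hiso, by omega, fun hδ => ?_, C₂, hF⟩))))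
      rw [hlam0 hδ, mul_one] at hF
      exact hsix i hi0 (by
        rw [hF, mul_comp, polyR_comp_quarter hi, polyST_comp_quarter hi, mul_assoc])
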